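/- An automatic algebra is a set with a binary operation $\mathbf M=\langle Q\cup\Sigma\cup\{0\};\cdot\rangle$, where $Q$ (states), $\Sigma$ (letters) and $\{0\}$ are pairwise disjoint, that encodes a partial automaton with state set $Q$ and alphabet $\Sigma$: for $q,r\in Q$ and $a\in\Sigma$ we have $q\cdot a=r$ if and only if $q\xrightarrow{a}r$ (for each $q$ and $a$ there is at most one such $r$), and all other products are $0$. Products are bracketed from the left: $xy_1y_2\cdots y_m=(\cdots((x\cdot y_1)\cdot y_2)\cdots)\cdot y_m$. Let $\mathbf N$ be a finite algebra with one binary operation. An alter ego of $\mathbf N$ is a structure $\mathbb N=\langle N;G,H,R,\mathcal T\rangle$, where $\mathcal T$ is the discrete topology, $G$ is a set of homomorphisms $\mathbf N^n\to\mathbf N$, $H$ is a set of partial operations on $N$ whose graphs are subuniverses of finite powers of $\mathbf N$, and $R$ is a set of subuniverses of finite powers $\mathbf N^n$. The algebra $\mathbf N$ is dualizable if it has an alter ego $\mathbb N$ such that, for every non-empty algebra $\mathbf A$ isomorphic to a subalgebra of a power of $\mathbf N$, every continuous map $f\colon\hom(\mathbf A,\mathbf N)\to N$ that preserves all members of $G\cup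 H\cup R$ is an evaluation, i.e. there is $a\in A$ with $f(x)=x(a)$ for all $x\in\hom(\mathbf A,\mathbf N)$; here $\hom(\mathbf A,\mathbf N)\subseteq N^A$ carries the subspace topology of the product topology, and $G$, $H$, $R$ act on it pointwise. A finite algebra $\mathbf M$ is inherently non-dualizable if no finite algebra that has $\mathbf M$ as a subalgebra is dualizable. **Theorem 2.6.** If a finite automatic algebra $\mathbf M$ fails the quasi-equation $$xy_1y_2\cdots y_m\approx 0\ \Longrightarrow\ xy_{\varphi(1)}y_{\varphi(2)}\cdots y_{\varphi(m)}\approx 0$$ for some $m\in\mathbb N$ and some permutation $\varphi$ of $\{1,2,\dots,m\}$, then $\mathbf M$ is inherently non-dualizable. -/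

import Mathlib

universe u v

/-! ### Automatic algebras -/

/-- The universe `Q ∪ S ∪ {0}` (disjoint union) of the automatic algebra encoding the partial
automaton with state set `Q`, alphabet `S` and partial transition function `δ`; here
`δ q a = some r` means `q →a r`, and `δ q a = none` means that `a` is undefined at `q`. -/
inductive AutomaticAlgebra {Q : Type u} {S : Type v} (δ : Q → S → Option Q) : Type (max u v)
  | zero : AutomaticAlgebra δ
  | state : Q → AutomaticAlgebra δ
  | letter : S → AutomaticAlgebra δ

namespace AutomaticAlgebra

instance {Q : Type u} {S : Type v} (δ : Q → S → Option Q) : Zero (AutomaticAlgebra δ) :=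
  ⟨AutomaticAlgebra.zero⟩

/-- `q · a = r` if `q →a r`; all other products are `0`. -/
def mul {Q : Type u} {S : Type v} (δ : Q → S → Option Q) :
    AutomaticAlgebra δ → AutomaticAlgebra δ → AutomaticAlgebra δ
  | state q, letter a => (δ q a).elim zero state
  | _, _ => zero

instance {Q : Type u} {S : Type v} (δ : Q → S → Option Q) : Mul (AutomaticAlgebra δ) :=
  ⟨AutomaticAlgebra.mul δ⟩

end AutomaticAlgebra

/-- The left-bracketed product `(⋯((x y₁) y₂) ⋯) yₘ`. -/
def leftProd {M : Type u} [Mul M] {m : ℕ} (x : M) (y : Fin m → M) : M :=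
  (List.ofFn y).foldl (fun s t => s * t) x

/-- The quasi-equation `x y₁ ⋯ yₘ ≈ 0 ⟹ x y_{φ(1)} ⋯ y_{φ(m)} ≈ 0` holds in `M`. -/
def SatisfiesPermQuasiEquation (M : Type u) [Mul M] [Zero M] (m : ℕ) (φ : Equiv.Perm (Fin m)) :
    Prop :=
  ∀ (x : M) (y : Fin m → M), leftProd x y = 0 → leftProd x (fun i => y (φ i)) = 0

/-! ### Dualizability of finite algebras with one binary operation -/

/-- An alter ego of the algebra `M`: a structure on the set `M` (with the discrete topology) given
by finitary total operations, partial operations and relations, all compatible with `M`: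
the relations are subuniverses of powers `Mⁿ` (with coordinatewise multiplication), the total
operations are homomorphisms `Mⁿ → M`, and the graphs of the partial operations are
subuniverses. -/
structure AlterEgo (M : Type u) [Mul M] where
  ops : Set (Σ n : ℕ, (Fin n → M) → M)
  partialOps : Set (Σ n : ℕ, (Fin n → M) →. M)
  rels : Set (Σ n : ℕ, Set (Fin n → M))
  ops_compatible : ∀ g ∈ ops, ∀ s t : Fin g.1 → M, g.2 (s * t) = g.2 s * g.2 t
  partialOps_compatible : ∀ h ∈ partialOps, ∀ (s t : Fin h.1 → M) (b c : M),
    b ∈ h.2 s → c ∈ h.2 t → b * c ∈ h.2 (s * t)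
  rels_compatible : ∀ r ∈ rels, ∀ s ∈ r.2, ∀ t ∈ r.2, s * t ∈ r.2

/-- The topology on `hom(A, M)` as a subspace of the power `M^A`, where `M` is discrete. -/
abbrev homTopology (A M : Type u) [Mul A] [Mul M] : TopologicalSpace (A →ₙ* M) :=
  TopologicalSpace.induced (fun x : A →ₙ* M => (x : A → M))
    (@Pi.topologicalSpace A (fun _ => M) (fun _ => ⊥))

/-- `f : hom(A, M) → M` is a morphism from the dual of `A`, that is, from the topological structure
`hom(A, M) ≤ E^A`, to the alter ego `E`: it is continuous and preserves the operations, partial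
operations and relations of `E`, interpreted pointwise on `hom(A, M)`. -/
structure AlterEgo.IsMorphism {M : Type u} [Mul M] (E : AlterEgo M) {A : Type u} [Mul A]
    (f : (A →ₙ* M) → M) : Prop where
  continuous : @Continuous _ _ (homTopology A M) ⊥ f
  map_ops : ∀ g ∈ E.ops, ∀ (x : Fin g.1 → (A →ₙ* M)) (y : A →ₙ* M),
    (∀ a, y a = g.2 (fun i => x i a)) → f y = g.2 (fun i => f (x i))
  map_partialOps : ∀ h ∈ E.partialOps, ∀ (x : Fin h.1 → (A →ₙ* M)) (y : A →ₙ* M),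
    (∀ a, y a ∈ h.2 (fun i => x i a)) → f y ∈ h.2 (fun i => f (x i))
  map_rels : ∀ r ∈ E.rels, ∀ x : Fin r.1 → (A →ₙ* M),
    (∀ a, (fun i => x i a) ∈ r.2) → (fun i => f (x i)) ∈ r.2

/-- `A ∈ ISP(M)`: `A` is isomorphic to a subalgebra of a power of `M`. -/
def MemISP (A M : Type u) [Mul A] [Mul M] : Prop :=
  ∃ (I : Type u) (e : A →ₙ* (I → M)), Function.Injective e

/-- `M` is dualizable: some alter ego `E` of `M` yields a duality on `ISP(M)`, that is, for every
(non-empty) algebra `A ∈ ISP(M)`, the morphisms from the dual of `A` to `E` are exactly the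
evaluations. (Evaluations always are morphisms, and distinct elements of `A` always give distinct
evaluations, so only surjectivity of the evaluation map has to be demanded.) -/
def Dualizable (M : Type u) [Mul M] : Prop :=
  ∃ E : AlterEgo M, ∀ (A : Type u) [Mul A] [Nonempty A], MemISP A M →
    ∀ f : (A →ₙ* M) → M, E.IsMorphism f → ∃ a : A, ∀ x : A →ₙ* M, f x = x a

/-- `M` is inherently non-dualizable: every finite algebra that has (an isomorphic copy of) `M` as
a subalgebra is non-dualizable. -/
def InherentlyNonDualizable (M : Type u) [Mul M] : Prop :=
  ∀ (N : Type u) [Mul N] [Finite N] (e : M →ₙ* N), Function.Injective e → ¬ Dualizable N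

/-! Non-dualizability is proved by ghosts: a sequence in a subalgebra of a power of `M` on which
every homomorphism to a finite algebra is constant up to boundedly many terms, and whose pointwise
limit lies outside the subalgebra. Sending a homomorphism to its almost constant value is a morphism
for every alter ego, yet not an evaluation. As the bound involves only the size of the target, every
finite extension of `M` is covered.

There are two sources of ghosts. In `inherentlyNonDualizable_of_grid` the coordinates are the cells
of `ℕ × ℕ`, and the sequence consists of tuples supported on one cell, obtained by intersecting a
row (the state tuple) with a column (the letters). In `inherentlyNonDualizable_of_colours` there is
one coordinate per colour, and the sequence consists of tuples that vanish at two colours; a finite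
target confuses colours, and this allows the zero set to be enlarged.

Suppose that `M` is not inherently non-dualizable. Each forbidden ghost is then a closure property
of the automaton. Grid ghosts show that a readable letter can be repeated and that totality passes
backwards along edges. If readability depends on the order of letters, take a minimal alphabet `Γ`
on which it does: a readable word that misses a letter of `Γ` then makes all words in its letters
readable. There is a strongly connected set `C` of states at which `Γ` can be exhausted but not
every word over `Γ` can be read (`Core`). A walk that has left `C` dies as soon as the letters read
since then exhaust `Γ`; the contrast between looping in `C` and dying outside feeds the colour
ghosts.

Let `V` be a minimal letter set of a closed walk in `C`. If `V` has two letters, replacing one by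
another eventually drives the walk out of `C`, and substitution yields a ghost
(`false_of_proper_walk` if `V ≠ Γ`, `false_of_unique_next` if `V = Γ`). If `V = {α}`, there is an
`α`-cycle; then every letter of `Γ` labels a cycle, some edge leaves `C` (`false_of_closed`), and
such an edge contradicts `false_of_cycle_of_total`. -/

/-! ### Ghost elements -/

/-- The ghost element method: if almost all members of a pointwise convergent sequence in `A` have
the same image under every homomorphism to a finite algebra, with a bound on the number of
exceptions that depends on the size of the algebra only, and the limit is not in `A`, then `M` is
inherently non-dualizable. -/
theorem inherentlyNonDualizable_of_ghost {M : Type u} [Mul M] {Z : Type}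
    (A : Subsemigroup (Z → M)) (a : ℕ → A) (g : Z → M) (hg : g ∉ A)
    (hlim : ∀ z, {t | (a t : Z → M) z ≠ g z}.Finite) (ν : ℕ → ℕ)
    (hν : ∀ (B : Type u) [Mul B] [Finite B] (h : A →ₙ* B),
      ∃ b, {t | h (a t) ≠ b}.encard ≤ ν (Nat.card B)) :
    InherentlyNonDualizable M := by
  classical
  rintro N _ _ e he ⟨E, hE⟩
  choose F hF using fun x : A →ₙ* N => hν N x
  have hFfin : ∀ x, {t | x (a t) ≠ F x}.Finite := fun x => Set.finite_of_encard_le_coe (hF x)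
  have huniq : ∀ (x : A →ₙ* N) (c : N), {t | x (a t) ≠ c}.Finite → F x = c := by
    intro x c hc
    obtain ⟨t, ht⟩ := ((hFfin x).union hc).exists_notMem
    simp only [Set.mem_union, Set.mem_ofPred_eq, not_or, not_not] at ht
    exact ht.1.symm.trans ht.2
  have hlocal : ∀ (n : ℕ) (x : Fin n → (A →ₙ* N)),
      {t | ∃ i, x i (a t) ≠ F (x i)}.Finite := by
    intro n x
    convert Set.finite_iUnion fun i => hFfin (x i) using 1
    ext t
    simp
  have heval : ∀ (n : ℕ) (x : Fin n → (A →ₙ* N)),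
      ∃ t, (fun i => x i (a t)) = fun i => F (x i) := by
    intro n x
    obtain ⟨t, ht⟩ := (hlocal n x).exists_notMem
    exact ⟨t, funext fun i => by_contra fun h => ht ⟨i, h⟩⟩
  have heval' : ∀ (n : ℕ) (x : Fin n → (A →ₙ* N)) (y : A →ₙ* N),
      ∃ t, y (a t) = F y ∧ (fun i => x i (a t)) = fun i => F (x i) := by
    intro n x y
    obtain ⟨t, ht⟩ := ((hFfin y).union (hlocal n x)).exists_notMem
    simp only [Set.mem_union, not_or] at ht
    exact ⟨t, not_not.1 ht.1, funext fun i => by_contra fun h => ht.2 ⟨i, h⟩⟩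
  have hmem : MemISP A N := by
    refine ⟨ULift.{u} Z, ⟨fun b z => e ((b : Z → M) z.down), ?_⟩, ?_⟩
    · intro b c; funext z; simp
    · intro b c hbc
      apply Subtype.ext; funext z
      exact he (congrFun hbc ⟨z⟩)
  have : Nonempty A := ⟨a 0⟩
  have hmor : E.IsMorphism F := by
    refine ⟨?_, ?_, ?_, ?_⟩
    · let : TopologicalSpace N := ⊥
      have : DiscreteTopology N := ⟨rfl⟩
      let : TopologicalSpace (A →ₙ* N) := homTopology A N
      have hloc : IsLocallyConstant F := by
        rw [IsLocallyConstant.iff_exists_open]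
        intro x
        set m := ν (Nat.card N) with hm
        -- Each homomorphism has at most `m` exceptional terms, so two that agree on `2m + 1` terms
        -- share a term that is exceptional for neither.
        refine ⟨⋂ t ∈ Finset.range (2 * m + 1), {y : A →ₙ* N | y (a t) = x (a t)}, ?_, ?_, ?_⟩
        · refine isOpen_biInter_finset fun t _ => ?_
          have : Continuous fun y : A →ₙ* N => y (a t) :=
            (continuous_apply (a t)).comp continuous_induced_dom
          exact (isOpen_discrete {x (a t)}).preimage this
        · simp
        · intro y hy
          simp only [Set.mem_iInter, Set.mem_ofPred_eq, Finset.mem_range] at hy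
          by_contra hne
          have hsub : (↑(Finset.range (2 * m + 1)) : Set ℕ) ⊆
              {t | x (a t) ≠ F x} ∪ {t | y (a t) ≠ F y} := by
            intro t ht
            by_contra hcon
            simp only [Set.mem_union, Set.mem_ofPred_eq, not_or, not_not] at hcon
            apply hne
            rw [← hcon.1, ← hcon.2, hy t (by simpa using ht)]
          have h1 := (Set.encard_le_encard hsub).trans (Set.encard_union_le _ _)
          have h2 := h1.trans (add_le_add (hF x) (hF y))
          rw [Set.encard_coe_eq_coe_finsetCard, Finset.card_range] at h2
          have h3 : (2 * m + 1 : ℕ) ≤ m + m := by exact_mod_cast h2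
          omega
      exact hloc.continuous
    · intro p hp x y hxy
      obtain ⟨t, h1, h2⟩ := heval' _ x y
      rw [← h1, ← h2]; exact hxy _
    · intro p hp x y hxy
      obtain ⟨t, h1, h2⟩ := heval' _ x y
      rw [← h1, ← h2]; exact hxy _
    · intro r hr x hx
      obtain ⟨t, h⟩ := heval _ x
      rw [← h]; exact hx _
  obtain ⟨b, hb⟩ := hE A hmem F hmor
  apply hg
  -- Each coordinate projection followed by `e` is a homomorphism whose almost constant value is `e
  -- (g z)`.
  have : g = (b : Z → M) := by
    funext z
    have hz := hb ⟨fun c => e ((c : Z → M) z), fun c d => by simp⟩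
    rw [huniq _ (e (g z)) ?_] at hz
    · exact he hz
    · refine (hlim z).subset fun t ht h => ht ?_
      simp [h]
  rw [this]; exact b.2

/-! ### Ghosts built from words -/

namespace AutomaticAlgebra

variable {Q : Type u} {S : Type v} (δ : Q → S → Option Q)

/-- The element of the algebra given by a state, or `0`. -/
def ofState : Option Q → AutomaticAlgebra δ
  | none => zero
  | some q => state q

/-- The element of the algebra given by a letter, or `0`. -/
def ofLetter : Option S → AutomaticAlgebra δ
  | none => zero
  | some a => letter a

/-- One step of the automaton; `none` stands for `0`. -/
def step (o : Option Q) (l : Option S) : Option Q := o.bind fun q => l.bind fun a => δ q a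

theorem ofState_injective : Function.Injective (ofState δ) := by
  rintro (_ | _) (_ | _) h <;> simp_all [ofState]

theorem ofState_mul_ofLetter (o : Option Q) (l : Option S) :
    ofState δ o * ofLetter δ l = ofState δ (step δ o l) := by
  cases o <;> cases l <;> simp only [ofState, ofLetter, step, HMul.hMul, Mul.mul, mul] <;> try rfl
  rename_i q a
  simp only [Option.bind_some]
  cases δ q a <;> rfl

theorem ofState_mul_ofState (o p : Option Q) : ofState δ o * ofState δ p = zero := by
  cases o <;> cases p <;> rfl

theorem ofLetter_mul (l : Option S) (x : AutomaticAlgebra δ) : ofLetter δ l * x = zero := by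
  cases l <;> cases x <;> rfl

theorem zero_mul' (x : AutomaticAlgebra δ) : zero * x = zero := by
  cases x <;> rfl

theorem ofState_mul_zero (o : Option Q) : ofState δ o * zero = zero := by
  cases o <;> rfl

/-- Value of a word in letter tuples, started at a tuple of states. -/
def val {Z ι κ : Type*} (X : ι → Z → Option Q) (l : κ → Z → Option S) (x : ι) (w : List κ) (z : Z) :
    Option Q :=
  w.foldl (fun o k => step δ o (l k z)) (X x z)

/-- The ghost element method for the algebra generated by tuples of states and tuples of letters. -/
theorem inherentlyNonDualizable_of_words {Z : Type} (c : Z) {ι κ : Type*}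
    (X : ι → Z → Option Q) (l : κ → Z → Option S)
    (x : ℕ → ι) (w : ℕ → List κ) (g : Z → Option Q) (hgc : g c ≠ none)
    (hg : ∀ i L, val δ X l i L ≠ g)
    (hlim : ∀ z, {t | val δ X l (x t) (w t) z ≠ g z}.Finite) (ν : ℕ → ℕ)
    (hν : ∀ (B : Type (max u v)) [Mul B] [Finite B] (hX : ι → B) (hl : κ → B),
      (∀ i L j L', val δ X l i L = val δ X l j L' →
        (L.map hl).foldl (· * ·) (hX i) = (L'.map hl).foldl (· * ·) (hX j)) →
      ∃ b, {t | ((w t).map hl).foldl (· * ·) (hX (x t)) ≠ b}.encard ≤ ν (Nat.card B)) :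
    InherentlyNonDualizable (AutomaticAlgebra δ) := by
  -- All tuples that vanish at `c` are thrown in: they absorb every product other than a state tuple
  -- times a letter tuple, and the ghost is not one of them.
  let A : Subsemigroup (Z → AutomaticAlgebra δ) :=
    { carrier := {t | t c = zero ∨ (∃ k, t = fun z => ofLetter δ (l k z)) ∨
        ∃ i L, t = fun z => ofState δ (val δ X l i L z)}
      mul_mem' := by
        rintro s t (hs | ⟨k, rfl⟩ | ⟨i, L, rfl⟩) ht
        · left; rw [Pi.mul_apply, hs]; exact zero_mul' δ _
        · left; rw [Pi.mul_apply]; exact ofLetter_mul δ _ _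
        · rcases ht with ht | ⟨k, rfl⟩ | ⟨j, L', rfl⟩
          · left; rw [Pi.mul_apply, ht]; exact ofState_mul_zero δ _
          · right; right
            refine ⟨i, L ++ [k], ?_⟩
            funext z
            rw [Pi.mul_apply, ofState_mul_ofLetter, val, val, List.foldl_append]
            rfl
          · left; rw [Pi.mul_apply]; exact ofState_mul_ofState δ _ _ }
  let el : κ → A := fun k => ⟨fun z => ofLetter δ (l k z), Or.inr (Or.inl ⟨k, rfl⟩)⟩
  let ev : ι → List κ → A := fun i L =>
    ⟨fun z => ofState δ (val δ X l i L z), Or.inr (Or.inr ⟨i, L, rfl⟩)⟩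
  have hev : ∀ (i : ι) (L : List κ), ev i L = (L.map el).foldl (· * ·) (ev i []) := by
    intro i L
    induction L using List.reverseRecOn with
    | nil => rfl
    | append_singleton L k ih =>
      rw [List.map_append, List.foldl_append, ← ih]
      apply Subtype.ext
      funext z
      change ofState δ (val δ X l i (L ++ [k]) z) = ofState δ _ * ofLetter δ _
      rw [ofState_mul_ofLetter, val, val, List.foldl_append]
      rfl
  refine inherentlyNonDualizable_of_ghost A (fun t => ev (x t) (w t)) (fun z => ofState δ (g z))
    ?_ ?_ ν ?_
  · rintro (h | ⟨k, h⟩ | ⟨i, L, h⟩)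
    · exact hgc (ofState_injective δ h)
    · have := congrFun h c
      revert this
      cases hc : g c with
      | none => exact absurd hc hgc
      | some q => cases l k c <;> simp [ofState, ofLetter]
    · refine hg i L (funext fun z => ?_)
      exact ofState_injective δ (congrFun h z).symm
  · intro z
    refine (hlim z).subset fun t ht h => ht ?_
    change ofState δ _ = _
    rw [h]
  · intro B _ _ h
    have hh : ∀ (i : ι) (L : List κ),
        h (ev i L) = (L.map fun k => h (el k)).foldl (· * ·) (h (ev i [])) := by
      intro i L
      induction L using List.reverseRecOn with
      | nil => rfl
      | append_singleton L k ih =>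
        rw [hev, List.map_append, List.foldl_append, ← hev, List.map_append, List.foldl_append, ← ih]
        exact map_mul h _ _
    obtain ⟨b, hb⟩ := hν B (fun i => h (ev i [])) (fun k => h (el k)) (by
      intro i L j L' hval
      rw [← hh, ← hh]
      congr 1
      apply Subtype.ext
      simp only [ev, hval])
    refine ⟨b, ?_⟩
    simpa only [fun t => hh (x t) (w t)] using hb

end AutomaticAlgebra

/-! ### Counting exceptions for rows and columns -/

/-- The map sending `t` to the value of `A` on the initial segment below `t` is injective on
exceptional points. If `s < t` have the same value, `Ψ · s` passes from `∅` to the segment below `s`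
(neither contains `s`), then to the segment below `t`, then to `univ` (both contain `s`), without
changing. -/
theorem encard_ne_le_of_pigeonhole {β γ : Type*} [Finite β] (A : Set ℕ → β) (Ψ : Set ℕ → ℕ → γ)
    (hA : ∀ U V t, A U = A V → Ψ U t = Ψ V t)
    (hΨ : ∀ U V t, (t ∈ U ↔ t ∈ V) → Ψ U t = Ψ V t) :
    {t | Ψ ∅ t ≠ Ψ Set.univ t}.encard ≤ Nat.card β := by
  have hinj : Set.InjOn (fun t => A {j | j < t}) {t | Ψ ∅ t ≠ Ψ Set.univ t} := by
    have key : ∀ s t, s < t → A {j | j < s} = A {j | j < t} → Ψ ∅ s = Ψ Set.univ s := by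
      intro s t hst h
      rw [hΨ ∅ {j | j < s} s (by simp), hA _ _ s h]
      exact hΨ _ _ s (by simpa using hst)
    intro s hs t ht h
    rcases lt_trichotomy s t with hst | hst | hst
    · exact absurd (key s t hst h) hs
    · exact hst
    · exact absurd (key t s hst h.symm) ht
  rw [← hinj.encard_image]
  refine (Set.encard_le_encard (Set.subset_univ _)).trans ?_
  rw [Set.encard_univ, ENat.card_eq_coe_natCard]

/-- Since `Φ` depends only on the intersection, a row can be changed into another one by way of a
set meeting the given column in two cells; the pigeonhole bound makes any two rows agree at almost
all columns, and symmetrically for columns. Comparing sufficiently many rows then shows that row `0`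
is almost constant. -/
theorem exists_encard_ne_le_of_grid {B β₁ β₂ : Type*} [Finite β₁] [Finite β₂]
    (Φ : Set (ℕ × ℕ) → Set (ℕ × ℕ) → B) (α : Set (ℕ × ℕ) → β₁) (β : Set (ℕ × ℕ) → β₂)
    (hΦ : ∀ X X' C C', (∃ i, ∀ j, (i, j) ∈ X) → (∃ i, ∀ j, (i, j) ∈ X') →
      (∃ j, ∀ i, (i, j) ∈ C) → (∃ j, ∀ i, (i, j) ∈ C') → X ∩ C = X' ∩ C' → Φ X C = Φ X' C')
    (hα : ∀ X X' C, (∃ i, ∀ j, (i, j) ∈ X) → (∃ i, ∀ j, (i, j) ∈ X') → (∃ j, ∀ i, (i, j) ∈ C) →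
      α X = α X' → Φ X C = Φ X' C)
    (hβ : ∀ X C C', (∃ i, ∀ j, (i, j) ∈ X) → (∃ j, ∀ i, (i, j) ∈ C) → (∃ j, ∀ i, (i, j) ∈ C') →
      β C = β C' → Φ X C = Φ X C') :
    ∃ b, {t | Φ {p | p.1 = 0} {p | p.2 = t} ≠ b}.encard ≤
      ((2 * Nat.card β₂ + 1) * (2 * Nat.card β₁) : ℕ) := by
  set φ : ℕ → ℕ → B := fun i t => Φ {p | p.1 = i} {p | p.2 = t} with hφ
  -- Parts of row `l` are added to row `i`; against column `t`, only the cell `(l, t)` of the added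
  -- part matters.
  have row1 : ∀ i l, {t | φ i t ≠ Φ {p | p.1 = i ∨ p = (l, t)} {p | p.2 = t}}.encard ≤
      Nat.card β₁ := by
    intro i l
    convert encard_ne_le_of_pigeonhole (fun U => α {p | p.1 = i ∨ (p.1 = l ∧ p.2 ∈ U)})
      (fun U t => Φ {p | p.1 = i ∨ (p.1 = l ∧ p.2 ∈ U)} {p | p.2 = t}) ?_ ?_ using 2
    · ext t
      have h1 : φ i t = Φ {p | p.1 = i ∨ (p.1 = l ∧ p.2 ∈ (∅ : Set ℕ))} {p | p.2 = t} := by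
        simp [hφ]
      have h2 : Φ {p | p.1 = i ∨ p = (l, t)} {p | p.2 = t} =
          Φ {p | p.1 = i ∨ (p.1 = l ∧ p.2 ∈ (Set.univ : Set ℕ))} {p | p.2 = t} := by
        refine hΦ _ _ _ _ ⟨i, by simp⟩ ⟨i, by simp⟩ ⟨t, by simp⟩ ⟨t, by simp⟩ ?_
        ext ⟨p, q⟩
        simp +contextual
      simp only [Set.mem_ofPred_eq, h1, h2]
    · intro U V t h
      exact hα _ _ _ ⟨i, by simp⟩ ⟨i, by simp⟩ ⟨t, by simp⟩ h
    · intro U V t h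
      refine hΦ _ _ _ _ ⟨i, by simp⟩ ⟨i, by simp⟩ ⟨t, by simp⟩ ⟨t, by simp⟩ ?_
      ext ⟨p, q⟩
      simp +contextual [h]
  have col1 : ∀ t r, {i | φ i t ≠ Φ {p | p.1 = i} {p | p.2 = t ∨ p = (i, r)}}.encard ≤
      Nat.card β₂ := by
    intro t r
    convert encard_ne_le_of_pigeonhole (fun U => β {p | p.2 = t ∨ (p.2 = r ∧ p.1 ∈ U)})
      (fun U i => Φ {p | p.1 = i} {p | p.2 = t ∨ (p.2 = r ∧ p.1 ∈ U)}) ?_ ?_ using 2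
    · ext i
      have h1 : φ i t = Φ {p | p.1 = i} {p | p.2 = t ∨ (p.2 = r ∧ p.1 ∈ (∅ : Set ℕ))} := by
        simp [hφ]
      have h2 : Φ {p | p.1 = i} {p | p.2 = t ∨ p = (i, r)} =
          Φ {p | p.1 = i} {p | p.2 = t ∨ (p.2 = r ∧ p.1 ∈ (Set.univ : Set ℕ))} := by
        refine hΦ _ _ _ _ ⟨i, by simp⟩ ⟨i, by simp⟩ ⟨t, by simp⟩ ⟨t, by simp⟩ ?_
        ext ⟨p, q⟩
        simp +contextual
      simp only [Set.mem_ofPred_eq, h1, h2]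
    · intro U V i h
      exact hβ _ _ _ ⟨i, by simp⟩ ⟨t, by simp⟩ ⟨t, by simp⟩ h
    · intro U V i h
      refine hΦ _ _ _ _ ⟨i, by simp⟩ ⟨i, by simp⟩ ⟨t, by simp⟩ ⟨t, by simp⟩ ?_
      ext ⟨p, q⟩
      simp +contextual [h]
  have row2 : ∀ i l, {t | φ i t ≠ φ l t}.encard ≤ (2 * Nat.card β₁ : ℕ) := by
    intro i l
    have hsub : {t | φ i t ≠ φ l t} ⊆ {t | φ i t ≠ Φ {p | p.1 = i ∨ p = (l, t)} {p | p.2 = t}} ∪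
        {t | φ l t ≠ Φ {p | p.1 = l ∨ p = (i, t)} {p | p.2 = t}} := by
      intro t ht
      by_contra h
      simp only [Set.mem_union, Set.mem_ofPred_eq, not_or, not_not] at h
      refine ht (h.1.trans (Eq.trans ?_ h.2.symm))
      refine hΦ _ _ _ _ ⟨i, by simp⟩ ⟨l, by simp⟩ ⟨t, by simp⟩ ⟨t, by simp⟩ ?_
      ext ⟨p, q⟩
      simp only [Set.mem_inter_iff, Set.mem_ofPred_eq, Prod.mk.injEq]
      tauto
    refine ((Set.encard_le_encard hsub).trans (Set.encard_union_le _ _)).trans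
      ((add_le_add (row1 i l) (row1 l i)).trans ?_)
    rw [two_mul]; push_cast; rfl
  have col2 : ∀ t r, {i | φ i t ≠ φ i r}.encard ≤ (2 * Nat.card β₂ : ℕ) := by
    intro t r
    have hsub : {i | φ i t ≠ φ i r} ⊆ {i | φ i t ≠ Φ {p | p.1 = i} {p | p.2 = t ∨ p = (i, r)}} ∪
        {i | φ i r ≠ Φ {p | p.1 = i} {p | p.2 = r ∨ p = (i, t)}} := by
      intro i hi
      by_contra h
      simp only [Set.mem_union, Set.mem_ofPred_eq, not_or, not_not] at h
      refine hi (h.1.trans (Eq.trans ?_ h.2.symm))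
      refine hΦ _ _ _ _ ⟨i, by simp⟩ ⟨i, by simp⟩ ⟨t, by simp⟩ ⟨r, by simp⟩ ?_
      ext ⟨p, q⟩
      simp only [Set.mem_inter_iff, Set.mem_ofPred_eq, Prod.mk.injEq]
      tauto
    refine ((Set.encard_le_encard hsub).trans (Set.encard_union_le _ _)).trans
      ((add_le_add (col1 t r) (col1 r t)).trans ?_)
    rw [two_mul]; push_cast; rfl
  -- One more than the number of rows in which two columns can differ. Where `K` further rows agree
  -- with row `0` at both `t` and `r`, a difference in row `0` would occur in all of them.
  set K := 2 * Nat.card β₂ + 1 with hK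
  set E : Set ℕ := ⋃ i ∈ Finset.range K, {t | φ 0 t ≠ φ (i + 1) t} with hE
  have hEcard : E.encard ≤ (K * (2 * Nat.card β₁) : ℕ) := by
    have : ∀ n, (⋃ i ∈ Finset.range n, {t | φ 0 t ≠ φ (i + 1) t}).encard ≤
        (n * (2 * Nat.card β₁) : ℕ) := by
      intro n
      induction n with
      | zero => simp
      | succ n ih =>
        rw [Finset.range_add_one, Finset.set_biUnion_insert, Set.union_comm]
        refine (Set.encard_union_le _ _).trans ((add_le_add ih (row2 0 (n + 1))).trans ?_)
        rw [add_mul, one_mul]; push_cast; rfl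
    exact this K
  obtain ⟨r, hr⟩ := (Set.finite_of_encard_le_coe hEcard).exists_notMem
  refine ⟨φ 0 r, (Set.encard_le_encard ?_).trans hEcard⟩
  intro t ht
  by_contra htE
  have hall : ∀ s, s ∉ E → ∀ i < K, φ 0 s = φ (i + 1) s := by
    intro s hs i hi
    by_contra h
    exact hs (Set.mem_biUnion (Finset.mem_coe.2 (Finset.mem_range.2 hi)) h)
  have hsub : (↑((Finset.range K).map ⟨(· + 1), add_left_injective 1⟩) : Set ℕ) ⊆
      {i | φ i t ≠ φ i r} := by
    intro i hi
    simp only [Finset.coe_map, Function.Embedding.coeFn_mk, Set.mem_image, Finset.coe_range,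
      Set.mem_Iio] at hi
    obtain ⟨j, hj, rfl⟩ := hi
    intro h
    exact ht ((hall t htE j hj).trans (h.trans (hall r hr j hj).symm))
  have := (Set.encard_le_encard hsub).trans (col2 t r)
  rw [Set.encard_coe_eq_coe_finsetCard, Finset.card_map, Finset.card_range] at this
  have h3 : K ≤ 2 * Nat.card β₂ := by exact_mod_cast this
  omega

/-! ### The rows-and-columns construction -/

namespace AutomaticAlgebra

variable {Q : Type u} {S : Type v} (δ : Q → S → Option Q)

theorem val_eq {Z ι κ : Type*} (X : ι → Z → Option Q) (l : κ → Z → Option S) (x : ι) (w : List κ)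
    (z : Z) : val δ X l x w z = (w.map (l · z)).foldl (step δ) (X x z) := by
  rw [val, List.foldl_map]

theorem foldl_step_none (w : List (Option S)) : w.foldl (step δ) none = none := by
  induction w with
  | nil => rfl
  | cons a w ih => exact ih

/-- The rows-and-columns construction. -/
theorem inherentlyNonDualizable_of_grid {T : Type*} [Finite T] (inn : T → S) (out : T → Option S)
    (s g : Q) (L₀ : List T) (hin : (L₀.map fun τ => some (inn τ)).foldl (step δ) (some s) = some g)
    (hout : (L₀.map out).foldl (step δ) (some s) = none)
    (hpos : ∀ L : List T, L ≠ [] →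
      (L.map fun τ => some (inn τ)).foldl (step δ) (some s) = some g →
      ∃ L₁ τ L₂, L = L₁ ++ τ :: L₂ ∧ ∀ W₁ W₂ : List (T × Prop), W₁.map Prod.fst = L₁ →
        W₂.map Prod.fst = L₂ → ∀ tok : T × Prop → Option S,
        (∀ p, p.2 → tok p = some (inn p.1)) → (∀ p, ¬ p.2 → tok p = out p.1) →
        (W₁.map tok ++ some (inn τ) :: W₂.map tok).foldl (step δ) (some s) ≠ none) :
    InherentlyNonDualizable (AutomaticAlgebra δ) := by
  classical
  let ι := {X : Set (ℕ × ℕ) // ∃ i, ∀ j, (i, j) ∈ X}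
  let κ := T × {C : Set (ℕ × ℕ) // ∃ j, ∀ i, (i, j) ∈ C}
  -- The coordinate `none` is a control at which every letter is read as `inn`. A state tuple is
  -- supported on a set containing a full row, and a letter is read as `inn` on a set containing a
  -- full column, as `out` off it.
  let X : ι → Option (ℕ × ℕ) → Option Q := fun X z =>
    z.elim (some s) fun p => if p ∈ X.1 then some s else none
  let l : κ → Option (ℕ × ℕ) → Option S := fun k z =>
    z.elim (some (inn k.1)) fun p => if p ∈ k.2.1 then some (inn k.1) else out k.1
  have hrow : ∀ i : ℕ, ∃ i', ∀ j, (i', j) ∈ {p : ℕ × ℕ | p.1 = i} := fun i => ⟨i, by simp⟩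
  have hcol : ∀ j : ℕ, ∃ j', ∀ i, (i, j') ∈ {p : ℕ × ℕ | p.2 = j} := fun j => ⟨j, by simp⟩
  have hval : ∀ (Y : ι) (C : {C : Set (ℕ × ℕ) // ∃ j, ∀ i, (i, j) ∈ C}),
      val δ X l Y (L₀.map fun τ => (τ, C)) =
        fun z => z.elim (some g) fun p => if p ∈ Y.1 ∩ C.1 then some g else none := by
    intro Y C
    funext z
    rw [val_eq, List.map_map]
    cases z with
    | none => exact hin
    | some p =>
      simp only [X, l, Option.elim_some, Set.mem_inter_iff]
      by_cases hp : p ∈ Y.1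
      · by_cases hC : p ∈ C.1
        · simp only [hp, hC, if_true, and_self]
          rw [← hin]
          congr 2
          funext τ
          simp [hC]
        · simp only [hp, hC, if_true, and_false, if_false]
          rw [← hout]
          congr 2
          funext τ
          simp [hC]
      · simp only [hp, if_false, false_and]
        exact foldl_step_none δ _
  refine inherentlyNonDualizable_of_words δ (Z := Option (ℕ × ℕ)) none X l
    (fun _ => ⟨_, hrow 0⟩) (fun t => L₀.map fun τ => (τ, ⟨_, hcol t⟩))
    (fun z => z.elim (some g) fun _ => none) (by simp) ?_ ?_
    (fun n => (2 * n ^ Nat.card T + 1) * (2 * n)) ?_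
  · intro Y L h
    by_cases hL : L = []
    · obtain ⟨Y, i, hi⟩ := Y
      have := congrFun h (some (i, 0))
      simp [hL, val, X, hi] at this
    · have h0 := congrFun h none
      rw [val_eq] at h0
      obtain ⟨L₁, τ, L₂, hsplit, hall⟩ := hpos (L.map Prod.fst) (by simpa using hL) (by
        rw [List.map_map]; exact h0)
      obtain ⟨M₁, M, rfl, hM₁, hM⟩ := List.map_eq_append_iff.1 hsplit
      obtain ⟨⟨τ', C⟩, M₂, rfl, rfl, hM₂⟩ := List.map_eq_cons_iff.1 hM
      -- The full row of the state tuple and the full column of the distinguished letter meet in a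
      -- cell where the product is not `0`, whatever the other letters do there.
      obtain ⟨i, hi⟩ := Y.2
      obtain ⟨j, hj⟩ := C.2
      refine hall (M₁.map fun k => (k.1, (i, j) ∈ k.2.1)) (M₂.map fun k => (k.1, (i, j) ∈ k.2.1))
        (by rw [List.map_map]; exact hM₁) (by rw [List.map_map]; exact hM₂)
        (fun p => if p.2 then some (inn p.1) else out p.1)
        (fun p hp => if_pos hp) (fun p hp => if_neg hp) ?_
      have h1 := congrFun h (some (i, j))
      rw [val_eq] at h1
      simp only [List.map_append, List.map_cons, X, l, Option.elim_some, hi, hj, if_true] at h1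
      rw [List.map_map, List.map_map]
      exact h1
  · intro z
    cases z with
    | none => simp [hval]
    | some p =>
      refine (Set.finite_singleton p.2).subset ?_
      intro t ht
      by_contra hne
      apply ht
      rw [hval]
      have : p.2 ≠ t := fun h => hne h.symm
      simp [this]
  · intro B _ _ hX hl hrel
    -- Default value for sets without a full row or column.
    let d : B := hX ⟨_, hrow 0⟩
    have := exists_encard_ne_le_of_grid (B := B) (β₁ := B) (β₂ := T → B)
      (fun Y C => if h : (∃ i, ∀ j, (i, j) ∈ Y) ∧ (∃ j, ∀ i, (i, j) ∈ C) then
        ((L₀.map fun τ => ((τ, ⟨C, h.2⟩) : κ)).map hl).foldl (· * ·) (hX ⟨Y, h.1⟩) else d)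
      (fun Y => if h : ∃ i, ∀ j, (i, j) ∈ Y then hX ⟨Y, h⟩ else d)
      (fun C τ => if h : ∃ j, ∀ i, (i, j) ∈ C then hl (τ, ⟨C, h⟩) else d) ?_ ?_ ?_
    · obtain ⟨b, hb⟩ := this
      refine ⟨b, ?_⟩
      simp only [hrow, hcol, and_self, dif_pos] at hb
      simpa [Nat.card_fun] using hb
    · intro Y Y' C C' h1 h2 h3 h4 h
      simp only [h1, h2, h3, h4, and_self, dif_pos]
      apply hrel
      rw [hval, hval]
      simp only [h]
    · intro Y Y' C h1 h2 h3 h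
      simp only [h1, h2, h3, and_self, dif_pos] at h ⊢
      rw [h]
    · intro Y C C' h1 h2 h3 h
      simp only [h1, h2, h3, and_self, dif_pos] at h ⊢
      rw [List.map_map, List.map_map]
      congr 2

end AutomaticAlgebra

/-! ### Runs, and what grid ghosts forbid -/

namespace AutomaticAlgebra

variable {Q : Type u} {S : Type v} (δ : Q → S → Option Q)

/-- The state reached by a word; `none` if some transition is undefined. -/
def run (o : Option Q) (w : List S) : Option Q := w.foldl (fun o a => o.bind fun q => δ q a) o

@[simp] theorem run_nil (o : Option Q) : run δ o [] = o := rfl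

theorem run_append (o : Option Q) (w w' : List S) :
    run δ o (w ++ w') = run δ (run δ o w) w' := List.foldl_append

theorem run_cons (o : Option Q) (a : S) (w : List S) :
    run δ o (a :: w) = run δ (run δ o [a]) w := rfl

@[simp] theorem run_none (w : List S) : run δ none w = none := by
  induction w with
  | nil => rfl
  | cons a w ih => exact ih

theorem foldl_step_eq_run {T : Type*} (f : T → S) (o : Option Q) (w : List T) :
    (w.map fun τ => some (f τ)).foldl (step δ) o = run δ o (w.map f) := by
  rw [run, List.foldl_map, List.foldl_map]
  rfl

/-- All words over `Δ` can be read at `x`. -/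
def Total (x : Q) (Δ : Set S) : Prop := ∀ w : List S, (∀ a ∈ w, a ∈ Δ) → run δ (some x) w ≠ none

variable {δ}

theorem run_append_ne_none {o : Option Q} {w w' : List S} (h : run δ o (w ++ w') ≠ none) :
    run δ o w ≠ none := by
  intro h'
  rw [run_append, h', run_none] at h
  exact h rfl

theorem Total.mono {x : Q} {Δ Δ' : Set S} (h : Total δ x Δ') (hΔ : Δ ⊆ Δ') : Total δ x Δ :=
  fun w hw => h w fun a ha => hΔ (hw a ha)

theorem Total.of_run {x y : Q} {Δ : Set S} (h : Total δ x Δ) {w : List S} (hw : ∀ a ∈ w, a ∈ Δ)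
    (hy : run δ (some x) w = some y) : Total δ y Δ := by
  intro w' hw' h'
  refine h (w ++ w') (fun a ha => ?_) (by rw [run_append, hy, h'])
  rcases List.mem_append.1 ha with ha | ha
  exacts [hw a ha, hw' a ha]

/-- Otherwise use the grid with the single letter `a`, replaced by `0` off its column. A non-empty
word reaching the ghost's state has length one, as `aa` is dead. -/
theorem run_twice_ne_none (hM : ¬ InherentlyNonDualizable (AutomaticAlgebra δ)) {x : Q} {a : S}
    (h : run δ (some x) [a] ≠ none) : run δ (some x) [a, a] ≠ none := by
  intro haa
  obtain ⟨g, hg⟩ := Option.ne_none_iff_exists'.1 h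
  apply hM
  refine inherentlyNonDualizable_of_grid δ (T := Unit) (fun _ => a) (fun _ => none) x g [()]
    hg rfl ?_
  intro L hL hLg
  match L, hL with
  | [()], _ =>
    refine ⟨[], (), [], rfl, ?_⟩
    intro W₁ W₂ h1 h2 tok _ _
    rw [List.map_eq_nil_iff] at h1 h2
    subst h1 h2
    exact h
  | () :: () :: L, _ =>
    rw [foldl_step_eq_run] at hLg
    rw [List.map_cons, List.map_cons, show a :: a :: L.map (fun _ => a) =
      [a, a] ++ L.map (fun _ => a) from rfl, run_append, haa, run_none] at hLg
    exact absurd hLg (by simp)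

/-- Otherwise use the grid in which a type `e ∈ Δ` is read as `a` inside and as `e` outside, with a
dead word as `L₀`. Reading the first letter of any word as `a` leads to `y`, after which nothing
over `Δ` dies. -/
theorem total_of_total_next (hM : ¬ InherentlyNonDualizable (AutomaticAlgebra δ)) [Finite S]
    {x y : Q} {a : S} {Δ : Set S} (ha : a ∈ Δ) (hy : run δ (some x) [a] = some y)
    (h : Total δ y Δ) : Total δ x Δ := by
  intro w hw hdead
  have hwne : w ≠ [] := by
    rintro rfl
    simp at hdead
  apply hM
  obtain ⟨b, w', rfl⟩ := List.exists_cons_of_ne_nil hwne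
  obtain ⟨g, hg⟩ := Option.ne_none_iff_exists'.1
    (h (w'.map fun _ => a) (fun c hc => by
      obtain ⟨_, -, rfl⟩ := List.mem_map.1 hc
      exact ha))
  refine inherentlyNonDualizable_of_grid δ (T := Δ) (fun _ => a) (fun e => some e.1) x g
    ((b :: w').attach.map fun c => ⟨c.1, hw c.1 c.2⟩) ?_ ?_ ?_
  · rw [foldl_step_eq_run, List.map_map, ← hg, ← hy, ← run_cons]
    congr 1
    simp [List.map_const', Function.comp_def]
  · rw [foldl_step_eq_run, List.map_map]
    rw [← hdead]
    congr 1
    exact List.attach_map_subtype_val _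
  · intro L hL _
    obtain ⟨τ, L', rfl⟩ := List.exists_cons_of_ne_nil hL
    refine ⟨[], τ, L', rfl, ?_⟩
    intro W₁ W₂ h1 h2 tok ht1 ht2
    rw [List.map_eq_nil_iff] at h1
    subst h1
    classical
    have : W₂.map tok = (W₂.map fun p => some (if p.2 then a else p.1.1)) := by
      apply List.map_congr_left
      intro p _
      by_cases hp : p.2
      · rw [ht1 p hp, if_pos hp]
      · rw [ht2 p hp, if_neg hp]
    rw [List.map_nil, List.nil_append, this]
    change ((some a :: W₂.map fun p => some (if p.2 then a else p.1.1))).foldl (step δ) (some x)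
      ≠ none
    rw [List.foldl_cons, foldl_step_eq_run]
    change run δ (run δ (some x) [a]) _ ≠ none
    rw [hy]
    refine h _ fun c hc => ?_
    obtain ⟨p, -, rfl⟩ := List.mem_map.1 hc
    split
    exacts [ha, p.1.2]

/-- Otherwise use the grid in which only `a` is replaced, by `0`, outside. A word reaching `g`
contains `a` at most once, so with that position read inside, the mixed reading is the word itself.
-/
theorem exists_mem_twice (hM : ¬ InherentlyNonDualizable (AutomaticAlgebra δ)) [Finite S]
    {x g : Q} {a : S} {Γ : Set S} {w : List S} (ha : a ∈ Γ) (hw : ∀ b ∈ w, b ∈ Γ)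
    (hg : run δ (some x) (a :: w) = some g) :
    ∃ W W' W'' : List S, (∀ b ∈ W ++ a :: W' ++ a :: W'', b ∈ Γ) ∧
      run δ (some x) (W ++ a :: W' ++ a :: W'') = some g := by
  classical
  by_contra hno
  apply hM
  have haw : ∀ b ∈ a :: w, b ∈ Γ := by simpa using ⟨ha, hw⟩
  refine inherentlyNonDualizable_of_grid δ (T := Γ) (fun c => c.1)
    (fun c => if c.1 = a then none else some c.1) x g
    ((a :: w).attach.map fun c => ⟨c.1, haw c.1 c.2⟩) ?_ ?_ ?_
  · rw [foldl_step_eq_run, List.map_map, ← hg]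
    congr 1
    exact List.attach_map_subtype_val _
  · rw [List.attach_cons, List.map_cons, List.map_cons, List.foldl_cons, if_pos rfl]
    exact foldl_step_none δ _
  · intro L hL hLg
    rw [foldl_step_eq_run] at hLg
    have hpos : ∃ L₁ τ L₂, L = L₁ ++ τ :: L₂ ∧ ∀ c ∈ L₁ ++ L₂, c.1 ≠ a := by
      by_cases h : (⟨a, ha⟩ : Γ) ∈ L
      · obtain ⟨L₁, L₂, hL₁, hfree⟩ := List.eq_append_cons_of_mem h
        refine ⟨L₁, ⟨a, ha⟩, L₂, hL₁, ?_⟩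
        intro c hc hca
        obtain rfl : c = ⟨a, ha⟩ := Subtype.ext hca
        rcases List.mem_append.1 hc with hc | hc
        · exact hfree hc
        · obtain ⟨L₃, L₄, rfl⟩ := List.append_of_mem hc
          refine hno ⟨L₁.map Subtype.val, L₃.map Subtype.val, L₄.map Subtype.val, ?_, ?_⟩
          · intro b hb
            have : b ∈ L.map Subtype.val := by
              rw [hL₁]; simpa using hb
            obtain ⟨p, -, rfl⟩ := List.mem_map.1 this
            exact p.2
          · rw [← hLg, hL₁]
            simp
      · obtain ⟨τ, L', rfl⟩ := List.exists_cons_of_ne_nil hL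
        refine ⟨[], τ, L', rfl, ?_⟩
        intro c hc hca
        apply h
        obtain rfl : c = ⟨a, ha⟩ := Subtype.ext hca
        exact List.mem_cons_of_mem _ hc
    obtain ⟨L₁, τ, L₂, rfl, hfree⟩ := hpos
    refine ⟨L₁, τ, L₂, rfl, ?_⟩
    intro W₁ W₂ h1 h2 tok ht1 ht2
    have htok : ∀ p : Γ × Prop, p.1.1 ≠ a → tok p = some p.1.1 := by
      intro p hp
      by_cases h : p.2
      · exact ht1 p h
      · rw [ht2 p h, if_neg hp]
    have hW₁ : W₁.map tok = L₁.map fun c => some c.1 := by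
      rw [← h1, List.map_map]
      refine List.map_congr_left fun p hp => htok p (hfree _ ?_)
      rw [← h1]
      exact List.mem_append_left _ (List.mem_map_of_mem hp)
    have hW₂ : W₂.map tok = L₂.map fun c => some c.1 := by
      rw [← h2, List.map_map]
      refine List.map_congr_left fun p hp => htok p (hfree _ ?_)
      rw [← h2]
      exact List.mem_append_right _ (List.mem_map_of_mem hp)
    have : W₁.map tok ++ some τ.1 :: W₂.map tok = (L₁ ++ τ :: L₂).map fun c => some c.1 := by
      rw [hW₁, hW₂, List.map_append, List.map_cons]
    rw [this, foldl_step_eq_run, hLg]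
    simp

end AutomaticAlgebra

/-! ### Counting exceptions for colours -/

theorem encard_small_fibres_le {β : Type*} [Finite β] (f : ℕ → β) (k : ℕ) :
    {i | {j | f j = f i}.encard ≤ k}.encard ≤ (Nat.card β * k : ℕ) := by
  classical
  have hsub : {i | {j | f j = f i}.encard ≤ k} ⊆
      ⋃ c, {j | f j = c ∧ {j | f j = c}.encard ≤ k} := by
    intro i hi
    simp only [Set.mem_iUnion, Set.mem_ofPred_eq, exists_eq_left']
    exact hi
  have := Fintype.ofFinite β
  refine (Set.encard_le_encard hsub).trans ((Set.encard_iUnion_le_of_fintype _).trans ?_)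
  refine (Finset.sum_le_card_nsmul _ _ (k : ℕ∞) fun c _ => ?_).trans ?_
  · by_cases h : {j | f j = c}.encard ≤ k
    · simp [h]
    · simp [h]
  · simp

theorem encard_pairs_le (E : Set ℕ) (k : ℕ) (hE : E.encard ≤ k) :
    {t | 2 * t ∈ E ∨ 2 * t + 1 ∈ E}.encard ≤ (2 * k : ℕ) := by
  have h1 : {t | 2 * t ∈ E}.encard ≤ k := by
    rw [← Set.InjOn.encard_image (f := fun t => 2 * t) (fun a _ b _ h => by simpa using h)]
    refine (Set.encard_le_encard ?_).trans hE
    rintro _ ⟨t, ht, rfl⟩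
    exact ht
  have h2 : {t | 2 * t + 1 ∈ E}.encard ≤ k := by
    rw [← Set.InjOn.encard_image (f := fun t => 2 * t + 1) (fun a _ b _ h => by simpa using h)]
    refine (Set.encard_le_encard ?_).trans hE
    rintro _ ⟨t, ht, rfl⟩
    exact ht
  rw [Set.ofPred_or]
  refine (Set.encard_union_le _ _).trans ((add_le_add h1 h2).trans ?_)
  rw [two_mul]; push_cast; rfl

theorem exists_fibre_notMem {β : Type*} {f : ℕ → β} {i : ℕ}
    (hi : ¬ {j | f j = f i}.encard ≤ (3 : ℕ)) (a b c : ℕ) :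
    ∃ j, f j = f i ∧ j ≠ a ∧ j ≠ b ∧ j ≠ c := by
  by_contra h
  apply hi
  -- The threshold `3` for small fibres is the number of points to be avoided: the index itself and
  -- two marked colours.
  refine (Set.encard_le_encard (t := {a, b, c}) ?_).trans ?_
  · intro j hj
    by_contra hj'
    simp only [Set.mem_insert_iff, Set.mem_singleton_iff, not_or] at hj'
    exact h ⟨j, hj, hj'⟩
  · have := Finset.card_le_three (a := a) (b := b) (c := c)
    have h2 : ({a, b, c} : Set ℕ) = (({a, b, c} : Finset ℕ) : Set ℕ) := by simp
    rw [h2, Set.encard_coe_eq_coe_finsetCard]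
    exact_mod_cast this

/-- If all four indices lie in large fibres of `cl`, each has a companion in its fibre. Adding such
pairs one after another enlarges both `{2t, 2t+1}` and `{2r, 2r+1}` to the same set, so `p` agrees
on them. -/
theorem exists_encard_ne_le_of_merge {B β : Type*} [Finite β] (p : Finset ℕ → B) (cl : ℕ → β)
    (h : ∀ (K : Finset ℕ) (i j k₁ k₂ : ℕ), cl i = cl j → i ≠ j → k₁ ∈ K → k₂ ∈ K → k₁ ≠ k₂ →
      i ≠ k₁ → i ≠ k₂ → j ≠ k₁ → j ≠ k₂ → p K = p (K ∪ {i, j})) :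
    ∃ b, {t | p {2 * t, 2 * t + 1} ≠ b}.encard ≤ (2 * (Nat.card β * 3) : ℕ) := by
  set E : Set ℕ := {i | {j | cl j = cl i}.encard ≤ (3 : ℕ)} with hE
  have hexc := encard_pairs_le E _ (encard_small_fibres_le cl 3)
  obtain ⟨r, hr⟩ := (Set.finite_of_encard_le_coe hexc).exists_notMem
  refine ⟨p {2 * r, 2 * r + 1}, (Set.encard_le_encard ?_).trans hexc⟩
  intro t ht
  by_contra htE
  simp only [hE, Set.mem_ofPred_eq, not_or] at hr htE
  have htr : t ≠ r := by
    rintro rfl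
    exact ht rfl
  obtain ⟨a, ha, ha1, ha2, ha3⟩ := exists_fibre_notMem htE.1 (2 * t) (2 * r) (2 * r + 1)
  obtain ⟨a', ha', ha1', ha2', ha3'⟩ := exists_fibre_notMem htE.2 (2 * t + 1) (2 * r) (2 * r + 1)
  obtain ⟨b, hb, hb1, hb2, hb3⟩ := exists_fibre_notMem hr.1 (2 * r) (2 * t) (2 * t + 1)
  obtain ⟨b', hb', hb1', hb2', hb3'⟩ := exists_fibre_notMem hr.2 (2 * r + 1) (2 * t) (2 * t + 1)
  have hL :=
    (h {2 * t, 2 * t + 1} b (2 * r) (2 * t) (2 * t + 1) hb hb1 (by simp) (by simp) (by omega)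
        hb2 hb3 (by omega) (by omega)).trans <|
    (h _ b' (2 * r + 1) (2 * t) (2 * t + 1) hb' hb1' (by simp) (by simp) (by omega)
        hb2' hb3' (by omega) (by omega)).trans <|
    (h _ a (2 * t) (2 * r) (2 * r + 1) ha ha1 (by simp) (by simp) (by omega)
        ha2 ha3 (by omega) (by omega)).trans <|
    h _ a' (2 * t + 1) (2 * r) (2 * r + 1) ha' ha1' (by simp) (by simp) (by omega)
        ha2' ha3' (by omega) (by omega)
  have hR :=
    (h {2 * r, 2 * r + 1} a (2 * t) (2 * r) (2 * r + 1) ha ha1 (by simp) (by simp) (by omega)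
        ha2 ha3 (by omega) (by omega)).trans <|
    (h _ a' (2 * t + 1) (2 * r) (2 * r + 1) ha' ha1' (by simp) (by simp) (by omega)
        ha2' ha3' (by omega) (by omega)).trans <|
    (h _ b (2 * r) (2 * t) (2 * t + 1) hb hb1 (by simp) (by simp) (by omega)
        hb2 hb3 (by omega) (by omega)).trans <|
    h _ b' (2 * r + 1) (2 * t) (2 * t + 1) hb' hb1' (by simp) (by simp) (by omega)
        hb2' hb3' (by omega) (by omega)
  refine ht (hL.trans (Eq.trans (congrArg p ?_) hR.symm))
  ext x
  simp only [Finset.mem_union, Finset.mem_insert, Finset.mem_singleton]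
  tauto

/-! ### The colour construction -/

namespace AutomaticAlgebra

variable {Q : Type u} {S : Type v} (δ : Q → S → Option Q)

/-- A coloured type `(τ, c)` is read as the letter `col τ` where the colour `c` is marked and as
`gen τ` elsewhere. -/
def read {T κ : Type*} (gen col : T → S) (f : κ → Bool) (x : T × κ) : S :=
  bif f x.2 then col x.1 else gen x.1

/-- The construction with one coordinate for every colour. The tuples with value `0` at a finite set
of colours have the ghost with no such colour as their limit, and a letter of colour `i` may be
exchanged with the same letter of colour `j` whenever a congruence identifies them. -/
theorem inherentlyNonDualizable_of_colours {T : Type*} [Finite T] (up gen col : T → S)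
    (su s gu g : Q)
    (hGA : ∀ W : List (T × ℕ), run δ (some su) (W.map fun x => up x.1) = some gu →
      ∃ i, run δ (some s) (W.map (read gen col (fun c => decide (c = i)))) ≠ some g)
    (O : List (T × Fin 4)) (hup : run δ (some su) (O.map fun x => up x.1) = some gu)
    (hgen : run δ (some s) (O.map fun x => gen x.1) = some g)
    (h12 : run δ (some s) (O.map (read gen col ![true, true, false, false])) = some g)
    (h2 : run δ (some s) (O.map (read gen col ![false, true, false, false])) = none)
    (h3 : run δ (some s) (O.map (read gen col ![false, false, true, false])) = none)
    (h4 : run δ (some s) (O.map (read gen col ![false, false, false, true])) = none)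
    (h1 : run δ (some s) (O.map (read gen col ![true, false, false, false])) = none ∨
      run δ (some s) (O.map (read gen col ![true, false, false, false])) = some g)
    (E : List T) (hEup : run δ (some gu) (E.map up) = some gu)
    (hEgen : run δ (some g) (E.map gen) = some g) (hEcol : run δ (some g) (E.map col) = none) :
    InherentlyNonDualizable (AutomaticAlgebra δ) := by
  classical
  let X : Unit → Option ℕ → Option Q := fun _ z => z.elim (some su) fun _ => some s
  let l : T × ℕ → Option ℕ → Option S := fun x z =>
    z.elim (some (up x.1)) fun i => some (read gen col (fun c => decide (c = i)) x)
  -- `P K` vanishes exactly on the colours in `K`; the ghost is `P ∅`, with the control `none` at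
  -- `gu`.
  let P : Finset ℕ → Option ℕ → Option Q := fun K z =>
    z.elim (some gu) fun i => if i ∈ K then none else some g
  have hnone : ∀ W, val δ X l () W none = run δ (some su) (W.map fun x => up x.1) := by
    intro W
    rw [val_eq]
    exact foldl_step_eq_run δ (fun x : T × ℕ => up x.1) _ W
  have hsome : ∀ W i, val δ X l () W (some i) =
      run δ (some s) (W.map (read gen col (fun c => decide (c = i)))) := by
    intro W i
    rw [val_eq]
    exact foldl_step_eq_run δ (read gen col (fun c => decide (c = i))) _ W
  let paint : (Fin 4 → ℕ) → List (T × ℕ) := fun c => O.map fun x => (x.1, c x.2)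
  -- The word `E` in colour `i` annihilates coordinate `i` and fixes the state at every other one.
  let kill : Finset ℕ → List (T × ℕ) := fun K => K.toList.flatMap fun i => E.map fun τ => (τ, i)
  have hpup : ∀ c, (paint c).map (fun x => up x.1) = O.map fun x => up x.1 := by
    intro c
    rw [List.map_map]
    rfl
  have hpread : ∀ c i, (paint c).map (read gen col (fun c => decide (c = i))) =
      O.map (read gen col fun a => decide (c a = i)) := by
    intro c i
    rw [List.map_map]
    rfl
  have hkup : ∀ K, run δ (some gu) ((kill K).map fun x => up x.1) = some gu := by
    intro K
    simp only [kill]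
    induction K.toList with
    | nil => rfl
    | cons i L ih =>
      rw [List.flatMap_cons, List.map_append, run_append, List.map_map]
      exact (congrArg (fun o => run δ o _) hEup).trans ih
  have hkread : ∀ K i, run δ (some g) ((kill K).map (read gen col (fun c => decide (c = i)))) =
      if i ∈ K then none else some g := by
    intro K i
    simp only [kill, ← Finset.mem_toList]
    induction K.toList with
    | nil => rfl
    | cons k L ih =>
      rw [List.flatMap_cons, List.map_append, run_append, List.map_map]
      by_cases hk : k = i
      · have : read gen col (fun c => decide (c = i)) ∘ (fun τ : T => (τ, k)) = col := by
          funext τ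
          simp [read, hk]
        rw [this, hEcol, run_none]
        simp [hk]
      · have : read gen col (fun c => decide (c = i)) ∘ (fun τ : T => (τ, k)) = gen := by
          funext τ
          simp [read, hk]
        rw [this, hEgen, ih]
        simp [Ne.symm hk]
  have hword : ∀ (K D : Finset ℕ) (c : Fin 4 → ℕ),
      (∀ i, run δ (some s) (O.map (read gen col fun a => decide (c a = i))) =
        if i ∈ D then none else some g) → val δ X l () (paint c ++ kill K) = P (D ∪ K) := by
    intro K D c hc
    funext z
    cases z with
    | none =>
      rw [hnone, List.map_append, run_append, hpup, hup, hkup]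
      rfl
    | some i =>
      rw [hsome, List.map_append, run_append, hpread, hc]
      by_cases hi : i ∈ D
      · simp [hi, P]
      · simp [hi, P, hkread]
  have hrd : ∀ {f f' : Fin 4 → Bool}, f = f' → O.map (read gen col f) = O.map (read gen col f') :=
    fun h => by rw [h]
  have hvec : ∀ (c : Fin 4 → ℕ) (i : ℕ), (fun a => decide (c a = i)) =
      ![decide (c 0 = i), decide (c 1 = i), decide (c 2 = i), decide (c 3 = i)] := by
    intro c i
    funext a
    fin_cases a <;> rfl
  have hgen' : run δ (some s) (O.map (read gen col ![false, false, false, false])) = some g := by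
    rw [← hgen]
    congr 1
    refine List.map_congr_left fun x _ => ?_
    obtain ⟨τ, a⟩ := x
    fin_cases a <;> rfl
  -- Giving the first two colour slots the same colour `j` leaves coordinate `j` alive; the last two
  -- slots always kill.
  have hbase : ∀ j k₁ k₂, j ≠ k₁ → j ≠ k₂ → k₁ ≠ k₂ → ∀ K : Finset ℕ,
      val δ X l () (paint ![j, j, k₁, k₂] ++ kill K) = P ({k₁, k₂} ∪ K) := by
    intro j k₁ k₂ hj1 hj2 hk K
    apply hword
    intro i
    rw [hrd (hvec _ _)]
    by_cases hi : j = i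
    · subst hi
      simp [hj1, hj2, hj1.symm, hj2.symm, h12]
    · by_cases hi1 : k₁ = i
      · subst hi1
        simp [hj1, hk.symm, h3]
      · by_cases hi2 : k₂ = i
        · subst hi2
          simp [hj2, hk, h4]
        · simp [hi, hi1, hi2, Ne.symm hi1, Ne.symm hi2, hgen']
  -- Separating the first two slots kills `j`, and also `i` if the first alternative of `h1` holds.
  have hmerge : ∀ i j k₁ k₂, i ≠ j → i ≠ k₁ → i ≠ k₂ → j ≠ k₁ → j ≠ k₂ → k₁ ≠ k₂ →
      ∀ K : Finset ℕ, val δ X l () (paint ![i, j, k₁, k₂] ++ kill K) =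
        P ((if run δ (some s) (O.map (read gen col ![true, false, false, false])) = none then
          {i, j, k₁, k₂} else {j, k₁, k₂}) ∪ K) := by
    intro i j k₁ k₂ hij hi1 hi2 hj1 hj2 hk K
    apply hword
    intro m
    rw [hrd (hvec _ _)]
    by_cases hm : i = m
    · subst hm
      rcases h1 with h1 | h1 <;> simp [h1, hij, hij.symm, hi1.symm, hi2.symm, hi1, hi2]
    · by_cases hm' : j = m
      · subst hm'
        split <;> simp [hij, hj1.symm, hj2.symm, h2]
      · by_cases hm1 : k₁ = m
        · subst hm1
          split <;> simp [hi1, hj1, hk.symm, h3]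
        · by_cases hm2 : k₂ = m
          · subst hm2
            split <;> simp [hi2, hj2, hk, h4]
          · split <;> simp [hm, hm', hm1, hm2, Ne.symm hm, Ne.symm hm', Ne.symm hm1, Ne.symm hm2,
              hgen']
  refine inherentlyNonDualizable_of_words δ (Z := Option ℕ) none X l (fun _ => ())
    (fun t => paint ![2 * t + 2, 2 * t + 2, 2 * t, 2 * t + 1] ++ kill ∅) (P ∅) (by simp [P])
    ?_ ?_ (fun n => 2 * (n ^ Nat.card T * 3)) ?_
  · rintro ⟨⟩ W hW
    obtain ⟨i, hi⟩ := hGA W (by rw [← hnone, hW]; rfl)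
    apply hi
    rw [← hsome, hW]
    rfl
  · intro z
    refine (Set.finite_singleton (z.elim 0 fun i => i / 2)).subset fun t ht => ?_
    by_contra hne
    apply ht
    rw [hbase _ _ _ (by omega) (by omega) (by omega)]
    cases z with
    | none => rfl
    | some i =>
      have : i ≠ 2 * t ∧ i ≠ 2 * t + 1 := by
        have : t ≠ i / 2 := hne
        omega
      simp [P, this]
  · intro B _ _ hX hl hrel
    let F : List (T × ℕ) → B := fun W => (W.map hl).foldl (· * ·) (hX ())
    -- The image of `P K`, where `hX ()` is a default for tuples that no word produces.
    let p : Finset ℕ → B := fun K =>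
      if h : ∃ W, val δ X l () W = P K then F h.choose else hX ()
    have hp : ∀ K W, val δ X l () W = P K → p K = F W := by
      intro K W hW
      have h : ∃ W, val δ X l () W = P K := ⟨W, hW⟩
      simp only [p, dif_pos h]
      exact hrel _ _ _ _ (h.choose_spec.trans hW.symm)
    have key : ∀ (K : Finset ℕ) (i j k₁ k₂ : ℕ), (fun τ => hl (τ, i)) = (fun τ => hl (τ, j)) →
        i ≠ j → k₁ ∈ K → k₂ ∈ K → k₁ ≠ k₂ → i ≠ k₁ → i ≠ k₂ → j ≠ k₁ → j ≠ k₂ →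
        p K = p ((if run δ (some s) (O.map (read gen col ![true, false, false, false])) = none
          then {i, j, k₁, k₂} else {j, k₁, k₂}) ∪ K) := by
      intro K i j k₁ k₂ hcl hij hK1 hK2 hk hi1 hi2 hj1 hj2
      have e1 := hbase j k₁ k₂ hj1 hj2 hk K
      rw [Finset.union_eq_right.2 (by simp [Finset.insert_subset_iff, hK1, hK2])] at e1
      rw [hp _ _ e1, hp _ _ (hmerge i j k₁ k₂ hij hi1 hi2 hj1 hj2 hk K)]
      simp only [F, List.map_append]
      congr 2
      simp only [paint, List.map_map]
      refine List.map_congr_left fun x _ => ?_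
      obtain ⟨τ, a⟩ := x
      fin_cases a
      · exact (congrFun hcl τ).symm
      all_goals rfl
    have hmain : ∀ (K : Finset ℕ) (i j k₁ k₂ : ℕ), (fun τ => hl (τ, i)) = (fun τ => hl (τ, j)) →
        i ≠ j → k₁ ∈ K → k₂ ∈ K → k₁ ≠ k₂ → i ≠ k₁ → i ≠ k₂ → j ≠ k₁ → j ≠ k₂ →
        p K = p (K ∪ {i, j}) := by
      intro K i j k₁ k₂ hcl hij hK1 hK2 hk hi1 hi2 hj1 hj2
      have hx1 : ∀ x, x = k₁ → x ∈ K := fun x h => h ▸ hK1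
      have hx2 : ∀ x, x = k₂ → x ∈ K := fun x h => h ▸ hK2
      have e := key K i j k₁ k₂ hcl hij hK1 hK2 hk hi1 hi2 hj1 hj2
      split at e
      · rw [e]
        congr 1
        ext x
        simp only [Finset.mem_union, Finset.mem_insert, Finset.mem_singleton]
        have := hx1 x
        have := hx2 x
        tauto
      -- Only `j` has been added, so a second exchange with the roles of `i` and `j` reversed adds
      -- `i`.
      · rw [e, key _ j i k₁ k₂ hcl.symm hij.symm (by simp) (by simp) hk hj1 hj2 hi1 hi2, if_neg ‹_›]
        congr 1
        ext x
        simp only [Finset.mem_union, Finset.mem_insert, Finset.mem_singleton]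
        have := hx1 x
        have := hx2 x
        tauto
    obtain ⟨b, hb⟩ := exists_encard_ne_le_of_merge p (fun i τ => hl (τ, i)) hmain
    refine ⟨b, ?_⟩
    rw [Nat.card_fun] at hb
    refine le_of_eq_of_le (congrArg Set.encard (Set.ext fun t => ?_)) hb
    have e := hbase (2 * t + 2) (2 * t) (2 * t + 1) (by omega) (by omega) (by omega) ∅
    rw [Finset.union_empty] at e
    rw [Set.mem_ofPred_eq, Set.mem_ofPred_eq, hp _ _ e]

end AutomaticAlgebra

/-! ### Eventual periodicity -/

theorem exists_iterate_add_eq {α : Type*} [Finite α] (f : α → α) :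
    ∃ M > 0, ∀ k ≥ M, ∀ x, f^[k + M] x = f^[k] x := by
  obtain ⟨i, j, hij, h⟩ : ∃ i j : ℕ, i < j ∧ f^[i] = f^[j] := by
    obtain ⟨i, j, hne, h⟩ := Finite.exists_ne_map_eq_of_infinite fun n : ℕ => f^[n]
    rcases lt_or_gt_of_ne hne with hlt | hlt
    exacts [⟨i, j, hlt, h⟩, ⟨j, i, hlt, h.symm⟩]
  have hper : ∀ k ≥ i, ∀ x, f^[k + (j - i)] x = f^[k] x := by
    intro k hk x
    rw [show k + (j - i) = (k - i) + j by omega, Function.iterate_add_apply, ← h,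
      ← Function.iterate_add_apply, Nat.sub_add_cancel hk]
  have hmul : ∀ n k, k ≥ i → ∀ x, f^[k + n * (j - i)] x = f^[k] x := by
    intro n
    induction n with
    | zero => simp
    | succ n ih =>
      intro k hk x
      rw [add_mul, one_mul, ← add_assoc, hper _ (by omega), ih k hk]
  -- A positive multiple of the period that exceeds the preperiod serves as both.
  have hle : i + 1 ≤ (i + 1) * (j - i) := Nat.le_mul_of_pos_right _ (by omega)
  exact ⟨(i + 1) * (j - i), by omega, fun k hk => hmul _ k (by omega)⟩

theorem exists_iterate_add_mul_eq {α : Type*} [Finite α] (f : α → α) :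
    ∃ M > 0, ∀ n, ∀ k ≥ M, ∀ x, f^[k + n * M] x = f^[k] x := by
  obtain ⟨M, hM, h⟩ := exists_iterate_add_eq f
  refine ⟨M, hM, fun n => ?_⟩
  induction n with
  | zero => simp
  | succ n ih =>
    intro k hk x
    rw [add_mul, one_mul, ← add_assoc, h _ (by omega), ih k hk]

theorem exists_list_mem_iff {S : Type*} [Finite S] (Δ : Set S) : ∃ l : List S, ∀ a, a ∈ l ↔ a ∈ Δ :=
  ⟨Δ.toFinite.toFinset.toList, by simp⟩

/-! ### Order of letters, and cores -/

namespace AutomaticAlgebra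

variable {Q : Type u} {S : Type v} {δ : Q → S → Option Q}

theorem run_cons_some (x : Q) (a : S) (w : List S) : run δ (some x) (a :: w) = run δ (δ x a) w := rfl

theorem run_flatten_replicate (o : Option Q) (w : List S) (n : ℕ) :
    run δ o (List.replicate n w).flatten = (fun o => run δ o w)^[n] o := by
  induction n generalizing o with
  | zero => rfl
  | succ n ih =>
    rw [List.replicate_succ, List.flatten_cons, run_append, ih]
    rfl

theorem run_replicate (o : Option Q) (a : S) (n : ℕ) :
    run δ o (List.replicate n a) = (fun o => run δ o [a])^[n] o := by
  rw [← run_flatten_replicate]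
  congr 1
  induction n with
  | zero => rfl
  | succ n ih => rw [List.replicate_succ, List.replicate_succ, List.flatten_cons, ← ih]; rfl

theorem exists_run_of_run_append {x y : Q} {w w' : List S}
    (h : run δ (some x) (w ++ w') = some y) :
    ∃ z, run δ (some x) w = some z ∧ run δ (some z) w' = some y := by
  rw [run_append] at h
  cases hz : run δ (some x) w with
  | none => simp [hz] at h
  | some z => exact ⟨z, rfl, by rw [← hz]; exact h⟩

theorem exists_run_of_run_cons {x y : Q} {a : S} {w : List S}
    (h : run δ (some x) (a :: w) = some y) :
    ∃ z, δ x a = some z ∧ run δ (some z) w = some y :=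
  exists_run_of_run_append (w := [a]) h

theorem run_flatten_replicate_loop {x : Q} {w : List S} (h : run δ (some x) w = some x) (n : ℕ) :
    run δ (some x) (List.replicate n w).flatten = some x := by
  rw [run_flatten_replicate]
  exact Function.iterate_fixed h n

/-- Some word whose set of letters is `Γ` can be read at `x`. -/
def HasFull (δ : Q → S → Option Q) (Γ : Set S) (x : Q) : Prop :=
  ∃ w : List S, (∀ a, a ∈ w ↔ a ∈ Γ) ∧ run δ (some x) w ≠ none

theorem not_hasFull_of_run {Γ : Set S} {x y : Q} {w : List S} (hx : ¬ HasFull δ Γ x)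
    (hw : ∀ a ∈ w, a ∈ Γ) (hy : run δ (some x) w = some y) : ¬ HasFull δ Γ y := by
  rintro ⟨w', hw', h⟩
  refine hx ⟨w ++ w', fun a => ?_, by rwa [run_append, hy]⟩
  rw [List.mem_append, hw']
  exact ⟨fun h => h.elim (hw a) id, Or.inr⟩

theorem run_eq_none_of_not_hasFull {Γ : Set S} {x : Q} {w : List S} (hx : ¬ HasFull δ Γ x)
    (hw : ∀ a, a ∈ w ↔ a ∈ Γ) : run δ (some x) w = none := by
  by_contra h
  exact hx ⟨w, hw, h⟩

/-- Whether a word over `Δ` can be read does not depend on the order of its letters. -/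
def CommutesOn (δ : Q → S → Option Q) (Δ : Set S) : Prop :=
  ∀ (x : Q) (w w' : List S), w.Perm w' → (∀ a ∈ w, a ∈ Δ) →
    run δ (some x) w ≠ none → run δ (some x) w' ≠ none

/-- A letter of `w` can be permuted to the end, doubled there by `run_twice_ne_none`, and permuted
back. So any word in the letters of `w` can be appended to `w`, and then moved to the front. -/
theorem CommutesOn.total_of_run (hM : ¬ InherentlyNonDualizable (AutomaticAlgebra δ)) {Δ : Set S}
    (hΔ : CommutesOn δ Δ) {x : Q} {w : List S} (hw : ∀ a ∈ w, a ∈ Δ)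
    (h : run δ (some x) w ≠ none) : Total δ x {a | a ∈ w} := by
  have key : ∀ W : List S, (∀ a ∈ W, a ∈ w) → run δ (some x) (w ++ W) ≠ none := by
    intro W
    induction W using List.reverseRecOn with
    | nil => simpa using h
    | append_singleton W a ih =>
      intro hW
      have ha : a ∈ w := hW a (by simp)
      have hall : ∀ b ∈ w ++ W, b ∈ Δ := by
        intro b hb
        rcases List.mem_append.1 hb with hb | hb
        exacts [hw b hb, hw b (hW b (by simp [hb]))]
      obtain ⟨L₁, L₂, hL⟩ := List.append_of_mem (List.mem_append_left W ha)
      have hp : (w ++ W).Perm ((L₁ ++ L₂) ++ [a]) := by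
        rw [hL]
        exact List.perm_middle.trans (List.perm_append_singleton a _).symm
      have h1 := hΔ x _ _ hp hall (ih fun b hb => hW b (by simp [hb]))
      obtain ⟨y, hy⟩ := Option.ne_none_iff_exists'.1 (run_append_ne_none h1)
      rw [run_append, hy] at h1
      have h2 := run_twice_ne_none hM h1
      have h3 : run δ (some x) ((L₁ ++ L₂) ++ [a, a]) ≠ none := by
        rw [run_append, hy]
        exact h2
      refine hΔ x _ _ ?_ (fun b hb => ?_) h3
      · rw [← List.append_assoc, show [a, a] = [a] ++ [a] from rfl, ← List.append_assoc]
        exact hp.symm.append_right [a]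
      · have : b ∈ (L₁ ++ L₂) ++ [a] ∨ b = a := by
          simp only [List.mem_append, List.mem_cons, List.not_mem_nil, or_false] at hb ⊢
          tauto
        rcases this with hb | rfl
        exacts [hall b (hp.mem_iff.2 hb), hw _ ha]
  intro W hW
  refine run_append_ne_none (w' := w) (hΔ x _ _ List.perm_append_comm (fun b hb => ?_) (key W hW))
  rcases List.mem_append.1 hb with hb | hb
  exacts [hw b hb, hw b (hW b hb)]

/-- A strongly connected set `C` of states, over an alphabet `Γ` that is minimal among those on
which the order of letters matters. -/
structure Core (δ : Q → S → Option Q) (Γ : Set S) (C : Set Q) : Prop where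
  not_inherent : ¬ InherentlyNonDualizable (AutomaticAlgebra δ)
  total_of_run : ∀ (x : Q) (w : List S), (∀ a ∈ w, a ∈ Γ) → (∃ c ∈ Γ, c ∉ w) →
    run δ (some x) w ≠ none → Total δ x {a | a ∈ w}
  exists_ne : ∀ a, ∃ b ∈ Γ, b ≠ a
  nonempty : C.Nonempty
  hasFull : ∀ x ∈ C, HasFull δ Γ x
  not_total : ∀ x ∈ C, ¬ Total δ x Γ
  connected : ∀ x ∈ C, ∀ y ∈ C, ∃ w : List S, (∀ a ∈ w, a ∈ Γ) ∧ run δ (some x) w = some y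
  not_hasFull : ∀ x ∈ C, ∀ (w : List S) (y : Q), (∀ a ∈ w, a ∈ Γ) → run δ (some x) w = some y →
    y ∉ C → ¬ HasFull δ Γ y

theorem Total.of_run_total (hM : ¬ InherentlyNonDualizable (AutomaticAlgebra δ)) [Finite S]
    {Γ : Set S} {x y : Q} {w : List S} (hw : ∀ a ∈ w, a ∈ Γ) (hy : run δ (some x) w = some y)
    (h : Total δ y Γ) : Total δ x Γ := by
  induction w generalizing x with
  | nil =>
    obtain rfl : x = y := by simpa using hy
    exact h
  | cons a w ih =>
    obtain ⟨z, hz, hzy⟩ := exists_run_of_run_cons hy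
    exact total_of_total_next hM (hw a (by simp)) hz (ih (fun b hb => hw b (by simp [hb])) hzy)

/-- `Γ` is minimal among the alphabets on which order matters. Among states where `Γ` can be
exhausted but not all words are readable, `q` has the fewest reachable states; `C` is the part
reachable from `q` where `Γ` can still be exhausted. Totality would pass back to `q`, so minimality
makes `C` strongly connected. -/
theorem exists_core [Finite Q] [Finite S] (hM : ¬ InherentlyNonDualizable (AutomaticAlgebra δ))
    (h : ¬ CommutesOn δ Set.univ) : ∃ Γ C, Core δ Γ C := by
  obtain ⟨Γ, hΓ, hmin⟩ : ∃ Γ : Set S, ¬ CommutesOn δ Γ ∧ ∀ Δ ⊂ Γ, CommutesOn δ Δ := by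
    obtain ⟨Γ, hΓ⟩ := (Set.toFinite {Γ : Set S | ¬ CommutesOn δ Γ}).exists_minimal ⟨_, h⟩
    refine ⟨Γ, hΓ.prop, fun Δ hΔ => ?_⟩
    by_contra hcon
    exact hΔ.2 (hΓ.le_of_le hcon hΔ.1)
  have htot : ∀ (x : Q) (w : List S), (∀ a ∈ w, a ∈ Γ) → (∃ c ∈ Γ, c ∉ w) →
      run δ (some x) w ≠ none → Total δ x {a | a ∈ w} := by
    rintro x w hw ⟨c, hc, hcw⟩ hx
    exact (hmin {a | a ∈ w} ⟨hw, fun h => hcw (h hc)⟩).total_of_run hM (fun a ha => ha) hx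
  simp only [CommutesOn, not_forall] at hΓ
  obtain ⟨x₀, w, w', hperm, hw, hx, hx'⟩ := hΓ
  rw [not_not] at hx'
  have hw' : ∀ a ∈ w', a ∈ Γ := fun a ha => hw a (hperm.mem_iff.2 ha)
  have hfull : ∀ a, a ∈ w ↔ a ∈ Γ := by
    refine fun a => ⟨hw a, fun ha => ?_⟩
    by_contra haw
    exact htot x₀ w hw ⟨a, ha, haw⟩ hx w' (fun b hb => hperm.mem_iff.2 hb) hx'
  have hne : ∀ a, ∃ b ∈ Γ, b ≠ a := by
    intro a
    by_contra hcon
    push Not at hcon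
    have e1 := List.eq_replicate_of_mem (fun b hb => hcon b (hw b hb))
    have e2 := List.eq_replicate_of_mem (fun b hb => hcon b (hw' b hb))
    rw [hperm.length_eq, ← e2] at e1
    exact hx (e1 ▸ hx')
  let R : Q → Set Q := fun x => {y | ∃ w : List S, (∀ a ∈ w, a ∈ Γ) ∧ run δ (some x) w = some y}
  have hRtrans : ∀ x y, y ∈ R x → R y ⊆ R x := by
    rintro x y ⟨w, hw, hy⟩ z ⟨w', hw', hz⟩
    refine ⟨w ++ w', fun a ha => ?_, by rw [run_append, hy, hz]⟩
    rcases List.mem_append.1 ha with ha | ha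
    exacts [hw a ha, hw' a ha]
  obtain ⟨q, ⟨hqF, hqT⟩, hqmin⟩ := Set.exists_min_image {x | HasFull δ Γ x ∧ ¬ Total δ x Γ}
    (fun x => (R x).ncard) (Set.toFinite _) ⟨x₀, ⟨w, hfull, hx⟩, fun hT => hT w' hw' hx'⟩
  have hRT : ∀ y ∈ R q, ¬ Total δ y Γ := by
    rintro y ⟨w, hw, hy⟩ hT
    exact hqT (hT.of_run_total hM hw hy)
  have hR : ∀ y ∈ R q, HasFull δ Γ y → R y = R q := by
    intro y hy hF
    exact Set.eq_of_subset_of_ncard_le (hRtrans _ _ hy) (hqmin y ⟨hF, hRT y hy⟩) (Set.toFinite _)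
  refine ⟨Γ, {y ∈ R q | HasFull δ Γ y}, hM, htot, hne, ⟨q, ⟨[], by simp, rfl⟩, hqF⟩,
    fun x hx => hx.2, fun x hx => hRT x hx.1, ?_, ?_⟩
  · rintro x ⟨hx, hxF⟩ y ⟨hy, -⟩
    rw [← hR x hx hxF] at hy
    exact hy
  · rintro x ⟨hx, -⟩ w y hw hy hyC hF
    exact hyC ⟨hRtrans _ _ hx ⟨w, hw, hy⟩, hF⟩

end AutomaticAlgebra

/-! ### Walks in a core -/

/-- The letters `α` are exchanged for those of `w` from left to right; `b` is the first exchange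
that destroys `P`. -/
theorem List.exists_hybrid {S : Type*} (α : S) (w : List S) (P : List S → Prop)
    (h : P (List.replicate w.length α)) (hw : ¬ P w) :
    ∃ w₁ b w₂, w = w₁ ++ b :: w₂ ∧ P (w₁ ++ α :: List.replicate w₂.length α) ∧
      ¬ P (w₁ ++ b :: List.replicate w₂.length α) := by
  induction w generalizing P with
  | nil => exact absurd h hw
  | cons a w ih =>
    by_cases ha : P (a :: List.replicate w.length α)
    · obtain ⟨w₁, b, w₂, rfl, h1, h2⟩ := ih (fun l => P (a :: l)) ha hw
      exact ⟨a :: w₁, b, w₂, rfl, h1, h2⟩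
    · exact ⟨[], a, w, rfl, h, ha⟩

namespace AutomaticAlgebra

variable {Q : Type u} {S : Type v} {δ : Q → S → Option Q}

theorem map_read_mark {T κ : Type*} (gen col : T → S) (f : κ → Bool) (c : κ) (w : List T) :
    (w.map fun τ => (τ, c)).map (read gen col f) = bif f c then w.map col else w.map gen := by
  rw [List.map_map]
  cases h : f c <;> exact List.map_congr_left fun τ _ => by simp [read, h]

namespace Core

variable {Γ : Set S} {C : Set Q}

/-- Once a walk leaves `C`, `Γ` can never again be exhausted, so it cannot return. -/
theorem mem_of_run_append (hc : Core δ Γ C) {x y : Q} {w w' : List S} (hx : x ∈ C)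
    (hw : ∀ a ∈ w, a ∈ Γ) (hw' : ∀ a ∈ w', a ∈ Γ) (h : run δ (some x) (w ++ w') = some y)
    (hy : y ∈ C) : ∃ z ∈ C, run δ (some x) w = some z ∧ run δ (some z) w' = some y := by
  obtain ⟨z, hz, hzy⟩ := exists_run_of_run_append h
  refine ⟨z, ?_, hz, hzy⟩
  by_contra hzC
  exact not_hasFull_of_run (hc.not_hasFull x hx w z hw hz hzC) hw' hzy (hc.hasFull y hy)

theorem total_of_not_hasFull (hc : Core δ Γ C) {x : Q} {w : List S} (hx : ¬ HasFull δ Γ x)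
    (hw : ∀ a ∈ w, a ∈ Γ) (h : run δ (some x) w ≠ none) : Total δ x {a | a ∈ w} := by
  refine hc.total_of_run x w hw ?_ h
  by_contra hcon
  push Not at hcon
  exact hx ⟨w, fun a => ⟨hw a, hcon a⟩, h⟩

/-- After a word that contains the letter `a`, a state from which `Γ` cannot be exhausted still
reads `a`. -/
theorem next_ne_none (hc : Core δ Γ C) {x g : Q} {w : List S} {a : S} (hx : ¬ HasFull δ Γ x)
    (hw : ∀ b ∈ w, b ∈ Γ) (ha : a ∈ w) (h : run δ (some x) w = some g) : δ g a ≠ none := by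
  have := hc.total_of_not_hasFull hx hw (by simp [h]) (w ++ [a]) (by
    intro b hb
    rcases List.mem_append.1 hb with hb | hb
    · exact hb
    · rw [List.mem_singleton.1 hb]; exact ha)
  rwa [run_append, h] at this

/-- If every edge at `q` leaves `C`, take a readable full word `a w` ending at `g`. A walk to `g`
that uses `a` twice uses it after leaving `C`, so `g` reads `a`; then `w a` exhausts `Γ` after the
first step, outside `C`. -/
theorem exists_next_mem [Finite S] (hc : Core δ Γ C) {q : Q} (hq : q ∈ C) :
    ∃ a ∈ Γ, ∃ y ∈ C, δ q a = some y := by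
  by_contra hno
  push Not at hno
  obtain ⟨w, hw, halive⟩ := hc.hasFull q hq
  have hexit : ∀ a ∈ Γ, ∀ y, δ q a = some y → ¬ HasFull δ Γ y := fun a ha y hy =>
    hc.not_hasFull q hq [a] y (by simpa using ha) hy fun hyC => hno a ha y hyC hy
  cases w with
  | nil =>
    refine hc.not_total q hq fun w' hw' h => ?_
    cases w' with
    | nil => simp at h
    | cons a w' => simpa using (hw a).2 (hw' a (by simp))
  | cons a w =>
    have ha : a ∈ Γ := (hw a).1 (by simp)
    obtain ⟨g, hg⟩ := Option.ne_none_iff_exists'.1 halive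
    obtain ⟨z, hz, hzg⟩ := exists_run_of_run_cons hg
    have hwΓ : ∀ b ∈ w, b ∈ Γ := fun b hb => (hw b).1 (by simp [hb])
    obtain ⟨W, W', W'', hW, hWg⟩ := exists_mem_twice hc.not_inherent ha hwΓ hg
    have hga : δ g a ≠ none := by
      cases W with
      | nil =>
        obtain ⟨z', hz', hz'g⟩ := exists_run_of_run_cons
          (show run δ (some q) (a :: (W' ++ a :: W'')) = some g by simpa using hWg)
        exact hc.next_ne_none (hexit a ha z' hz') (fun b hb => hW b (by simp at hb ⊢; tauto))
          (by simp) hz'g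
      | cons c W =>
        obtain ⟨z', hz', hz'g⟩ := exists_run_of_run_cons
          (show run δ (some q) (c :: (W ++ a :: W' ++ a :: W'')) = some g by simpa using hWg)
        exact hc.next_ne_none (hexit c (hW c (by simp)) z' hz')
          (fun b hb => hW b (by simp at hb ⊢; tauto)) (by simp) hz'g
    refine hexit a ha z hz ⟨w ++ [a], fun b => ?_, ?_⟩
    · rw [← hw b]
      simp [or_comm]
    · rw [run_append, hzg]
      exact hga

end Core

/-! ### Marked letters read as one fixed letter -/

/-- The colouring construction in which marking a letter turns it into `α`. -/
theorem false_of_recolouring (hM : ¬ InherentlyNonDualizable (AutomaticAlgebra δ)) [Finite S]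
    {α : S} {s g : Q} (hsg : s ≠ g) (hgα : δ g α = none) (O : List (S × Fin 4))
    (hgen : run δ (some s) (O.map Prod.fst) = some g)
    (h12 : run δ (some s) (O.map (read id (fun _ => α) ![true, true, false, false])) = some g)
    (h2 : run δ (some s) (O.map (read id (fun _ => α) ![false, true, false, false])) = none)
    (h3 : run δ (some s) (O.map (read id (fun _ => α) ![false, false, true, false])) = none)
    (h4 : run δ (some s) (O.map (read id (fun _ => α) ![false, false, false, true])) = none)
    (h1 : run δ (some s) (O.map (read id (fun _ => α) ![true, false, false, false])) = none ∨
      run δ (some s) (O.map (read id (fun _ => α) ![true, false, false, false])) = some g)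
    {E : List S} (hE : E ≠ []) (hEg : run δ (some g) E = some g) : False := by
  refine hM (inherentlyNonDualizable_of_colours δ (T := S) id id (fun _ => α) s s g g ?_ O hgen hgen
    h12 h2 h3 h4 h1 E ?_ ?_ ?_)
  · intro W hW
    rcases List.eq_nil_or_concat W with rfl | ⟨W, ⟨a, i⟩, rfl⟩
    · exact ⟨0, fun h => hsg (by simpa using h)⟩
    -- At the colour of the last letter the walk enters `g` by `α`, so `α` could be read again at
    -- `g`.
    · refine ⟨i, fun h => ?_⟩
      rw [List.concat_eq_append, List.map_append] at h
      obtain ⟨x, -, hx⟩ := exists_run_of_run_append h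
      have hx' : run δ (some x) [α] = some g := by simpa [read] using hx
      have := run_twice_ne_none hM (by simp [hx'] : run δ (some x) [α] ≠ none)
      rw [show [α, α] = [α] ++ [α] from rfl, run_append, hx'] at this
      exact this hgα
  · simpa using hEg
  · simpa using hEg
  · obtain ⟨a, E, rfl⟩ := List.exists_cons_of_ne_nil hE
    rw [List.map_cons, run_cons_some, hgα, run_none]

/-- A block with two kinds of marks supplies all four colours. It is painted with colours `0, 1`,
then `2, 3`, then `3, 2`: marking only the `false` letters kills, and the swap makes each of the
colours `2` and `3` do so in one of the last two copies. -/
theorem false_of_block (hM : ¬ InherentlyNonDualizable (AutomaticAlgebra δ)) [Finite S]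
    {α : S} {s g : Q} (hsg : s ≠ g) (hgα : δ g α = none) {V : List (S × Bool)} {W : List S}
    (hV : run δ (some s) (V.map Prod.fst) = some s) (hW : run δ (some s) W = some g)
    (hVα : run δ (some s) (List.replicate V.length α) = some s)
    (hV1 : run δ (some s) (V.map (read id (fun _ => α) id)) = none ∨
      run δ (some s) (V.map (read id (fun _ => α) id)) = some s)
    (hV2 : run δ (some s) (V.map (read id (fun _ => α) not)) = none)
    {E : List S} (hE : E ≠ []) (hEg : run δ (some g) E = some g) : False := by
  have hmap : ∀ (f : Fin 4 → Bool) (i j : Fin 4),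
      (V.map fun x : S × Bool => (x.1, bif x.2 then i else j)).map (read id (fun _ => α) f) =
        V.map (read id (fun _ => α) fun b => bif b then f i else f j) := by
    intro f i j
    rw [List.map_map]
    refine List.map_congr_left ?_
    rintro ⟨a, b⟩ -
    cases b <;> rfl
  have e00 : V.map (read id (fun _ => α) fun _ => false) =
      V.map Prod.fst := List.map_congr_left (by rintro ⟨a, _ | _⟩ - <;> rfl)
  have e01 : V.map (read id (fun _ => α) fun b => !b) =
      V.map (read id (fun _ => α) not) := List.map_congr_left (by rintro ⟨a, _ | _⟩ - <;> rfl)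
  have e10 : V.map (read id (fun _ => α) fun b => b) =
      V.map (read id (fun _ => α) id) := List.map_congr_left (by rintro ⟨a, _ | _⟩ - <;> rfl)
  have e11 : V.map (read id (fun _ => α) fun _ => true) =
      V.map fun _ => α := List.map_congr_left (by rintro ⟨a, _ | _⟩ - <;> rfl)
  have hO : ∀ f : Fin 4 → Bool, ((V.map fun x : S × Bool => (x.1, bif x.2 then (0 : Fin 4) else 1)) ++
      (V.map fun x : S × Bool => (x.1, bif x.2 then (2 : Fin 4) else 3)) ++ (V.map fun x : S × Bool => (x.1, bif x.2 then (3 : Fin 4) else 2))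
      ++ W.map fun a => (a, (2 : Fin 4))).map (read id (fun _ => α) f) =
      V.map (read id (fun _ => α) fun b => bif b then f 0 else f 1) ++
      V.map (read id (fun _ => α) fun b => bif b then f 2 else f 3) ++
      V.map (read id (fun _ => α) fun b => bif b then f 3 else f 2) ++
      bif f 2 then W.map fun _ => α else W.map id := by
    intro f
    simp only [List.map_append, hmap, map_read_mark]
  refine false_of_recolouring hM hsg hgα ((V.map fun x : S × Bool => (x.1, bif x.2 then (0 : Fin 4) else 1)) ++
      (V.map fun x : S × Bool => (x.1, bif x.2 then (2 : Fin 4) else 3)) ++ (V.map fun x : S × Bool => (x.1, bif x.2 then (3 : Fin 4) else 2))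
      ++ W.map fun a => (a, (2 : Fin 4))) ?_ ?_ ?_ ?_ ?_ ?_ hE hEg
  · have hfst : ∀ i j : Fin 4, (V.map fun x : S × Bool => (x.1, bif x.2 then i else j)).map Prod.fst =
        V.map Prod.fst := fun i j => by rw [List.map_map]; rfl
    simp only [List.map_append, hfst, run_append, hV]
    simpa [Function.comp_def] using hW
  · rw [hO]
    simp [e00, e11, run_append, hV, hVα, hW]
  · rw [hO]
    simp [e00, e01, run_append, hV2]
  · rw [hO]
    rcases hV1 with h | h <;> simp [e00, e01, e10, run_append, hV, hV2, h]
  · rw [hO]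
    simp [e00, e01, e10, run_append, hV, hV2]
  · rw [hO]
    rcases hV1 with h | h <;> simp [e00, e10, run_append, hV, h, hW]

end AutomaticAlgebra

/-! ### Cores with a cycle labelled by one letter -/

namespace AutomaticAlgebra

variable {Q : Type u} {S : Type v} {δ : Q → S → Option Q}

theorem run_replicate_add (o : Option Q) (a : S) (m n : ℕ) :
    run δ o (List.replicate (m + n) a) = run δ (run δ o (List.replicate m a))
      (List.replicate n a) := by
  rw [List.replicate_add, run_append]

theorem run_replicate_mul_loop {x : Q} {a : S} {n : ℕ}
    (h : run δ (some x) (List.replicate n a) = some x) (m : ℕ) :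
    run δ (some x) (List.replicate (m * n) a) = some x := by
  induction m with
  | zero => simp
  | succ m ih => rw [add_mul, one_mul, run_replicate_add, ih, h]

namespace Core

variable {Γ : Set S} {C : Set Q}

theorem exists_run_cycle_mem (hc : Core δ Γ C) {α : S} (hα : α ∈ Γ) {q : Q} (hq : q ∈ C) {n : ℕ}
    (hn : 0 < n) (hcyc : run δ (some q) (List.replicate n α) = some q) (i : ℕ) :
    ∃ y ∈ C, run δ (some q) (List.replicate i α) = some y := by
  have h := run_replicate_mul_loop hcyc i
  have hi : i ≤ i * n := Nat.le_mul_of_pos_right _ hn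
  rw [show i * n = i + (i * n - i) by omega, List.replicate_add] at h
  have hall : ∀ (m : ℕ), ∀ a ∈ List.replicate m α, a ∈ Γ := fun m a ha =>
    (List.eq_of_mem_replicate ha) ▸ hα
  obtain ⟨z, hz, hqz, -⟩ := hc.mem_of_run_append hq (hall _) (hall _) h hq
  exact ⟨z, hz, hqz⟩

/-- Marking a colour turns letters into `α`, which loops harmlessly at `q` but is fatal at `g`, a
state reached outside `C` after all other letters of `Γ` have been read. One position, where
exchanging `α` for `b` breaks the return to `C`, carries its own colour `0`. -/
theorem false_of_cycle_of_total [Finite Q] [Finite S] (hc : Core δ Γ C) {α : S} (hα : α ∈ Γ) {q : Q}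
    (hq : q ∈ C) {n : ℕ} (hn : 0 < n) (hcyc : run δ (some q) (List.replicate n α) = some q)
    {p : List S} (hp : ∀ a ∈ p, a ∈ Γ) {z : Q} (hz : run δ (some q) p = some z) (hzC : z ∉ C)
    (hzT : Total δ z (Γ \ {α})) : False := by
  classical
  obtain ⟨κ, hκ⟩ := exists_list_mem_iff (Γ \ {α})
  have hzF : ¬ HasFull δ Γ z := hc.not_hasFull q hq p z hp hz hzC
  have hrep : ∀ (m : ℕ), ∀ a ∈ List.replicate m α, a ∈ Γ := fun m a ha =>
    (List.eq_of_mem_replicate ha) ▸ hα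
  obtain ⟨p₁, b, p₂, rfl, ⟨y, hy, hqy⟩, hbC⟩ := List.exists_hybrid α p
    (fun l => ∃ y ∈ C, run δ (some q) l = some y) (hc.exists_run_cycle_mem hα hq hn hcyc _)
    (by
      rintro ⟨y, hy, hqy⟩
      rw [hz] at hqy
      exact hzC (Option.some_injective _ hqy ▸ hy))
  have hb : b ∈ Γ := hp b (by simp)
  have hbα : b ≠ α := by
    rintro rfl
    exact hbC ⟨y, hy, hqy⟩
  have hp₁ : ∀ a ∈ p₁, a ∈ Γ := fun a ha => hp a (by simp [ha])
  obtain ⟨σ, hσ, hyq⟩ := hc.connected y hy q hq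
  set p := p₁ ++ b :: p₂ with hpdef
  set rest := σ ++ (List.replicate n α ++ (p ++ κ)) with hrest
  set tail := List.replicate p₂.length α ++ rest with htail
  have hrestfull : ∀ a, a ∈ rest ↔ a ∈ Γ := by
    intro a
    simp only [hrest, List.mem_append, hκ]
    constructor
    · rintro (h | h | h | h)
      exacts [hσ a h, hrep n a h, hp a h, h.1]
    · intro h
      by_cases haα : a = α
      · subst haα
        exact Or.inr (Or.inl (by simp [hn.ne']))
      · exact Or.inr (Or.inr (Or.inr ⟨h, haα⟩))
  have htailΓ : ∀ a ∈ tail, a ∈ Γ := by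
    intro a ha
    rcases List.mem_append.1 ha with ha | ha
    exacts [hrep _ a ha, (hrestfull a).1 ha]
  -- `Ω` returns to `q`, goes once round the cycle, then leaves `C` along `p` and reads `κ`; `Ω'` is
  -- its version without `α`.
  set Ω := p₁ ++ α :: tail with hΩ
  have hΩΓ : ∀ a ∈ Ω, a ∈ Γ := by
    intro a ha
    rcases List.mem_append.1 ha with ha | ha
    · exact hp₁ a ha
    · rcases List.mem_cons.1 ha with rfl | ha
      exacts [hα, htailΓ a ha]
  let sub : S → S := fun a => if a = α then b else a
  have hsub : ∀ a ∈ Γ, sub a ∈ Γ \ {α} := by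
    intro a ha
    by_cases h : a = α
    · simp [sub, h, hb, hbα]
    · simp [sub, h, ha]
  set Ω' := Ω.map sub with hΩ'
  have hΩ'B : ∀ a ∈ Ω', a ∈ Γ \ {α} := by
    intro a ha
    obtain ⟨c, hcΩ, rfl⟩ := List.mem_map.1 ha
    exact hsub c (hΩΓ c hcΩ)
  obtain ⟨z₁, hz₁⟩ := Option.ne_none_iff_exists'.1 (hzT κ fun a ha => (hκ a).1 ha)
  have hz₁T : Total δ z₁ (Γ \ {α}) := hzT.of_run (fun a ha => (hκ a).1 ha) hz₁
  have hqΩ : run δ (some q) Ω = some z₁ := by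
    have : Ω = (p₁ ++ α :: List.replicate p₂.length α) ++ rest := by
      simp [hΩ, htail]
    rw [this, run_append, hqy, hrest, run_append, hyq, run_append, hcyc, run_append, hz, hz₁]
  obtain ⟨M, hM, hper⟩ := exists_iterate_add_mul_eq fun o => run δ o Ω'
  -- The factor `n` makes `α` loop at `q` for the whole length, `M` makes `L (s + 1)` loop at `g`,
  -- and `2` ensures `M ≤ s`.
  obtain ⟨s, hs⟩ : ∃ s, s + 1 = 2 * n * M := ⟨2 * n * M - 1, by
    have : 0 < 2 * n * M := by positivity
    omega⟩
  have hle : 2 * M ≤ 2 * n * M := by nlinarith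
  have hMs : M ≤ s := by omega
  let L : ℕ → List S := fun k => (List.replicate k Ω').flatten
  have hLB : ∀ k, ∀ a ∈ L k, a ∈ Γ \ {α} := by
    intro k a ha
    obtain ⟨l, hl, ha⟩ := List.mem_flatten.1 ha
    exact hΩ'B a (List.eq_of_mem_replicate hl ▸ ha)
  have hLΓ : ∀ k, ∀ a ∈ L k, a ∈ Γ := fun k a ha => (hLB k a ha).1
  have hLlen : ∀ k, (L k).length = k * Ω.length := by
    intro k
    simp [L, hΩ']
  have hLne : ∀ k, 0 < k → L k ≠ [] := by
    intro k hk h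
    have := hLlen k
    rw [h, List.length_nil] at this
    have : 0 < k * Ω.length := Nat.mul_pos hk (by simp [hΩ])
    omega
  obtain ⟨g, hg⟩ := Option.ne_none_iff_exists'.1 (hz₁T (L s) (hLB s))
  have hgloop : run δ (some g) (L (s + 1)) = some g := by
    rw [← hg]
    simp only [L, run_flatten_replicate]
    rw [← Function.iterate_add_apply, add_comm, hs, hper _ _ hMs]
  have hgF : ¬ HasFull δ Γ g := by
    refine not_hasFull_of_run hzF (w := κ ++ L s) ?_ (by rw [run_append, hz₁, hg])
    intro a ha
    rcases List.mem_append.1 ha with ha | ha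
    exacts [((hκ a).1 ha).1, hLΓ s a ha]
  have hdead : ∀ W : List S, (∀ a ∈ W, a ∈ Γ) → α ∈ W → run δ (some g) W = none := by
    intro W hW hαW
    have := run_eq_none_of_not_hasFull hzF (w := (κ ++ L s) ++ W) (by
      intro a
      simp only [List.mem_append, hκ]
      constructor
      · rintro ((h | h) | h)
        exacts [h.1, hLΓ s a h, hW a h]
      · intro h
        by_cases haα : a = α
        · exact Or.inr (haα ▸ hαW)
        · exact Or.inl (Or.inl ⟨h, haα⟩))
    rwa [run_append, run_append, hz₁, hg] at this
  have hαcycle : run δ (some q) (List.replicate ((s + 1) * Ω.length) α) = some q := by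
    rw [hs, show 2 * n * M * Ω.length = (2 * M * Ω.length) * n by ring]
    exact run_replicate_mul_loop hcyc _
  -- With only colour `1` marked, the original letters of `Ω` reappear everywhere except at the
  -- position of colour `0`, which is `α` when that colour is marked too and `b` otherwise.
  let colour : S → S × Fin 4 := fun a => (sub a, if a = α then 1 else 2)
  let mid : List (S × Fin 4) := p₁.map colour ++ (b, 0) :: tail.map colour
  let rd : (Fin 4 → Bool) → S × Fin 4 → S := fun f => read id (fun _ => α) f
  have hrdΓ : ∀ f x, x.1 ∈ Γ → rd f x ∈ Γ := by
    intro f x hx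
    simp only [rd, read]
    cases f x.2
    exacts [hx, hα]
  have hmidΓ : ∀ f, ∀ a ∈ mid.map (rd f), a ∈ Γ := by
    intro f a ha
    obtain ⟨x, hx, rfl⟩ := List.mem_map.1 ha
    apply hrdΓ
    rcases List.mem_append.1 hx with hx | hx
    · obtain ⟨c, hc', rfl⟩ := List.mem_map.1 hx
      exact (hsub c (hp₁ c hc')).1
    · rcases List.mem_cons.1 hx with rfl | hx
      · exact hb
      · obtain ⟨c, hc', rfl⟩ := List.mem_map.1 hx
        exact (hsub c (htailΓ c hc')).1
  let O : List (S × Fin 4) := (Ω ++ L s).map (fun a => (a, 1)) ++ mid ++ (L s).map fun a => (a, 3)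
  have hO : ∀ f, O.map (rd f) = (bif f 1 then List.replicate ((s + 1) * Ω.length) α else Ω ++ L s) ++
      (mid.map (rd f) ++ bif f 3 then (L s).map (fun _ => α) else L s) := by
    intro f
    have hlen : (Ω ++ L s).length = (s + 1) * Ω.length := by
      rw [List.length_append, hLlen]; ring
    simp only [O, rd]
    rw [List.map_append, List.map_append, map_read_mark, map_read_mark, List.append_assoc,
      List.map_const', hlen, List.map_id, List.map_id]
  have hΩLs : run δ (some q) (Ω ++ L s) = some g := by rw [run_append, hqΩ, hg]
  have hmid1 : ∀ f : Fin 4 → Bool, f 1 = true → f 2 = false →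
      mid.map (rd f) = p₁ ++ (bif f 0 then α else b) :: tail := by
    intro f h1 h2
    have : rd f ∘ colour = id := by
      funext a
      by_cases h : a = α
      · simp [rd, read, colour, h, h1]
      · simp [rd, read, colour, h, h2, sub]
    simp only [mid, List.map_append, List.map_cons, List.map_map, this, List.map_id]
    rfl
  refine false_of_recolouring hc.not_inherent (α := α) (s := q) (g := g) ?_ ?_ O ?_ ?_ ?_ ?_ ?_ ?_
    (E := L (s + 1)) ?_ hgloop
  · rintro rfl
    exact hgF (hc.hasFull q hq)
  · exact hdead [α] (by simpa using hα) (by simp)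
  · have h1 : mid.map Prod.fst = Ω' := by
      simp only [mid, List.map_append, List.map_cons, List.map_map, hΩ', hΩ]
      congr 2
      simp [sub]
    have h2 : ∀ (l : List S) (i : Fin 4), (l.map fun a => (a, i)).map Prod.fst = l := by
      intro l i
      rw [List.map_map]
      exact List.map_id l
    simp only [O, List.map_append, h1, h2]
    rw [run_append, run_append, hΩLs, ← run_append]
    exact hgloop
  · rw [hO, hmid1 _ rfl rfl]
    change run δ (some q) (List.replicate ((s + 1) * Ω.length) α ++ (Ω ++ L s)) = some g
    rw [run_append, hαcycle, hΩLs]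
  · rw [hO, hmid1 _ rfl rfl]
    change run δ (some q) (List.replicate ((s + 1) * Ω.length) α ++ ((p₁ ++ b :: tail) ++ L s)) = none
    rw [run_append, hαcycle, run_append]
    have : p₁ ++ b :: tail = (p₁ ++ b :: List.replicate p₂.length α) ++ rest := by simp [htail]
    rw [this, run_append]
    cases hy' : run δ (some q) (p₁ ++ b :: List.replicate p₂.length α) with
    | none => simp
    | some y' =>
      have hy'F : ¬ HasFull δ Γ y' := by
        refine hc.not_hasFull q hq _ y' ?_ hy' fun h => hbC ⟨y', h, hy'⟩
        intro a ha
        rcases List.mem_append.1 ha with ha | ha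
        · exact hp₁ a ha
        · rcases List.mem_cons.1 ha with rfl | ha
          exacts [hb, hrep _ a ha]
      rw [run_eq_none_of_not_hasFull hy'F hrestfull, run_none]
  · rw [hO]
    change run δ (some q) ((Ω ++ L s) ++ (mid.map _ ++ L s)) = none
    rw [run_append, hΩLs, run_append, hdead _ (hmidΓ _), run_none]
    obtain ⟨c, hcΓ, hcα⟩ := hc.exists_ne α
    refine List.mem_map.2 ⟨colour c, ?_, by simp [rd, read, colour, hcα]⟩
    have : c ∈ tail := List.mem_append_right _ ((hrestfull c).2 hcΓ)
    exact List.mem_append_right _ (List.mem_cons_of_mem _ (List.mem_map_of_mem this))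
  · rw [hO]
    change run δ (some q) ((Ω ++ L s) ++ (mid.map _ ++ (L s).map fun _ => α)) = none
    rw [run_append, hΩLs, hdead]
    · intro a ha
      rcases List.mem_append.1 ha with ha | ha
      · exact hmidΓ _ a ha
      · obtain ⟨_, -, rfl⟩ := List.mem_map.1 ha
        exact hα
    · obtain ⟨a, ha⟩ := List.exists_mem_of_ne_nil _ (hLne s (by omega))
      exact List.mem_append_right _ (List.mem_map.2 ⟨a, ha, rfl⟩)
  · left
    rw [hO]
    change run δ (some q) ((Ω ++ L s) ++ (mid.map _ ++ L s)) = none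
    rw [run_append, hΩLs, run_append, hdead _ (hmidΓ _), run_none]
    simp [mid, rd, read]
  · exact hLne _ (by omega)

end Core
end AutomaticAlgebra

namespace AutomaticAlgebra

variable {Q : Type u} {S : Type v} {δ : Q → S → Option Q}

namespace Core

variable {Γ : Set S} {C : Set Q}

theorem mem_of_closed (hclosed : ∀ x ∈ C, ∀ a ∈ Γ, ∀ z, δ x a = some z → z ∈ C) {x y : Q} {w : List S} (hx : x ∈ C)
    (hw : ∀ a ∈ w, a ∈ Γ) (h : run δ (some x) w = some y) : y ∈ C := by
  induction w generalizing x with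
  | nil =>
    obtain rfl : x = y := by simpa using h
    exact hx
  | cons a w ih =>
    obtain ⟨z, hz, hzy⟩ := exists_run_of_run_cons h
    exact ih (hclosed x hx a (hw a (by simp)) z hz) (fun b hb => hw b (by simp [hb])) hzy

/-- The block is a walk `W` from `q'` to `y`, marked `true`, then `β`, marked `false`, and a return.
Marking `true` turns `W` into a loop of `α`s at `q'`; marking `false` puts an `α` at `y`, which is
fatal. The return is arranged so that the `true` marking either dies or comes back to `q'`. -/
theorem false_of_closed [Finite Q] [Finite S] (hc : Core δ Γ C)
    (hclosed : ∀ x ∈ C, ∀ a ∈ Γ, ∀ z, δ x a = some z → z ∈ C) {α β : S} (hα : α ∈ Γ) (hβ : β ∈ Γ)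
    {y : Q} (hy : y ∈ C) (hyα : δ y α = none) (hyβ : δ y β ≠ none) {q : Q} (hq : q ∈ C) {n : ℕ}
    (hn : 0 < n) (hcyc : run δ (some q) (List.replicate n α) = some q) : False := by
  have hM' := hc.not_inherent
  obtain ⟨M, hM, hper⟩ := exists_iterate_add_mul_eq fun o => run δ o [α]
  have hper' : ∀ m k, M ≤ k → ∀ o, run δ o (List.replicate (k + m * M) α) =
      run δ o (List.replicate k α) := by
    intro m k hk o
    rw [run_replicate, run_replicate, hper _ _ hk]
  have hqM : run δ (some q) (List.replicate M α) = some q := by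
    obtain ⟨n, rfl⟩ := Nat.exists_eq_succ_of_ne_zero hn.ne'
    rw [← hper' n M le_rfl, show M + n * M = M * n.succ by rw [Nat.succ_eq_add_one]; ring]
    exact run_replicate_mul_loop hcyc M
  obtain ⟨w, hw, hqy⟩ := hc.connected q hq y hy
  set m := w.length with hm
  obtain ⟨q', hq', hqq'⟩ := hc.exists_run_cycle_mem hα hq hn hcyc m
  have hq'M : run δ (some q') (List.replicate M α) = some q' := by
    rw [← hqq', ← run_replicate_add, add_comm, run_replicate_add, hqM]
  have hmK : m ≤ (m + 1) * M := by nlinarith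
  set W := List.replicate ((m + 1) * M - m) α ++ w with hWdef
  have hWlen : W.length = (m + 1) * M := by
    rw [hWdef, List.length_append, List.length_replicate, ← hm]; omega
  have hW : run δ (some q') W = some y := by
    rw [hWdef, run_append, ← hqq', ← run_replicate_add, Nat.add_sub_cancel' hmK,
      run_replicate_mul_loop hqM, hqy]
  have hq'W : run δ (some q') (List.replicate W.length α) = some q' := by
    rw [hWlen]; exact run_replicate_mul_loop hq'M _
  obtain ⟨y₁, hy₁⟩ := Option.ne_none_iff_exists'.1 hyβ
  obtain ⟨P, -, hP⟩ := hc.connected y₁ (hclosed y hy β hβ y₁ hy₁) q' hq'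
  have hyne : q' ≠ y := by
    rintro rfl
    obtain ⟨M', rfl⟩ := Nat.exists_eq_succ_of_ne_zero (by omega : M ≠ 0)
    rw [List.replicate_succ, run_cons_some, hyα, run_none] at hq'M
    simp at hq'M
  have hloop : run δ (some y) (β :: (P ++ W)) = some y := by
    rw [run_cons_some, hy₁, run_append, hP, hW]
  have hβloop : run δ (some q') (W ++ β :: P) = some q' := by
    rw [run_append, hW, run_cons_some, hy₁, hP]
  have hmark : ∀ (l : List S) (b : Bool) (f : Bool → Bool), (l.map fun a => (a, b)).map
      (read id (fun _ => α) f) = bif f b then List.replicate l.length α else l := by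
    intro l b f
    rw [map_read_mark, List.map_const', List.map_id]
  have hfst : ∀ (l : List S) (b : Bool), (l.map fun a => (a, b)).map Prod.fst = l := by
    intro l b
    rw [List.map_map]
    exact List.map_id l
  have main : ∀ U : List (S × Bool),
      run δ (some y) ((β, false) :: U |>.map Prod.fst) = some q' →
      (run δ (some q') (((β, false) :: U).map (read id (fun _ => α) id)) = none ∨
        run δ (some q') (((β, false) :: U).map (read id (fun _ => α) id)) = some q') → False := by
    intro U hU hU1
    let V₀ : List (S × Bool) := W.map (fun a => (a, true)) ++ (β, false) :: U
    have hV₀ : run δ (some q') (V₀.map Prod.fst) = some q' := by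
      rw [List.map_append, hfst, run_append, hW, hU]
    have hV₀1 : V₀.map (read id (fun _ => α) id) =
        List.replicate W.length α ++ ((β, false) :: U).map (read id (fun _ => α) id) := by
      rw [List.map_append, hmark]
      rfl
    have hV₀2 : run δ (some q') (V₀.map (read id (fun _ => α) not)) = none := by
      rw [List.map_append, hmark, run_append]
      change run δ (run δ (some q') W) (α :: _) = none
      rw [hW, run_cons_some, hyα, run_none]
    refine false_of_block hM' hyne hyα (V := (List.replicate M V₀).flatten) (W := W) ?_ hW ?_ ?_ ?_
      (List.cons_ne_nil _ _) hloop
    -- The block is repeated `M` times so that its length is a multiple of `M`, as the all-`α`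
    -- reading requires.
    · rw [List.map_flatten, List.map_replicate]
      exact run_flatten_replicate_loop hV₀ M
    · rw [List.length_flatten, List.map_replicate, List.sum_replicate, smul_eq_mul, mul_comm]
      exact run_replicate_mul_loop hq'M _
    · rw [List.map_flatten, List.map_replicate]
      rcases hU1 with h | h
      · left
        obtain ⟨M', rfl⟩ := Nat.exists_eq_succ_of_ne_zero (by omega : M ≠ 0)
        rw [List.replicate_succ, List.flatten_cons, run_append, hV₀1, run_append, hq'W, h, run_none]
      · right
        refine run_flatten_replicate_loop ?_ M
        rw [hV₀1, run_append, hq'W, h]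
    · rw [List.map_flatten, List.map_replicate]
      obtain ⟨M', rfl⟩ := Nat.exists_eq_succ_of_ne_zero (by omega : M ≠ 0)
      rw [List.replicate_succ, List.flatten_cons, run_append, hV₀2, run_none]
  have hbeta : ∀ (U : List (S × Bool)), ((β, false) :: U).map (read id (fun _ => α) id) =
      β :: U.map (read id (fun _ => α) id) := fun _ => rfl
  by_cases hdead : ∀ p, δ q' β = some p → δ p α = none
  · refine main ((P ++ List.replicate M α).map fun a => (a, true)) ?_ (Or.inl ?_)
    · rw [List.map_cons, hfst, run_cons_some, hy₁, run_append, hP, hq'M]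
    · rw [hbeta, hmark, run_cons_some]
      cases hp : δ q' β with
      | none => simp
      | some p =>
        change run δ (some p) (List.replicate _ α) = none
        obtain ⟨k, hk⟩ := Nat.exists_eq_succ_of_ne_zero
          (show (P ++ List.replicate M α).length ≠ 0 by simp; omega)
        rw [hk, List.replicate_succ, run_cons_some, hdead p hp, run_none]
  · push Not at hdead
    obtain ⟨p, hp, hpα⟩ := hdead
    have hpC : p ∈ C := hclosed q' hq' β hβ p hp
    have hpT : Total δ p {a | a ∈ [α]} := by
      obtain ⟨c, hcΓ, hcα⟩ := hc.exists_ne α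
      exact hc.total_of_run p [α] (by simpa using hα) ⟨c, hcΓ, by simpa using hcα⟩ hpα
    obtain ⟨p', hp'⟩ := Option.ne_none_iff_exists'.1
      (hpT (List.replicate M α) fun a ha => by simp [List.eq_of_mem_replicate ha])
    have hp'C : p' ∈ C := mem_of_closed hclosed hpC
      (fun a ha => List.eq_of_mem_replicate ha ▸ hα) hp'
    obtain ⟨P₂, -, hP₂⟩ := hc.connected p' hp'C q' hq'
    -- `G` leads from `y₁` to `p'`. The `M - 1` extra loops make its length a multiple of `M`, at
    -- least `M`, so that `α` repeated that often leads from `p` to `p'` as well.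
    let G : List S := P ++ ((List.replicate (M - 1) (W ++ β :: P)).flatten ++
      β :: List.replicate M α)
    have hG : run δ (some y₁) G = some p' := by
      simp only [G]
      rw [run_append, hP, run_append, run_flatten_replicate_loop hβloop, run_cons_some, hp, hp']
    have hGlen : G.length = M + (P.length + (M - 1) * (m + 1) + 1) * M := by
      obtain ⟨M', rfl⟩ := Nat.exists_eq_succ_of_ne_zero (by omega : M ≠ 0)
      simp only [G, List.length_append, List.length_flatten, List.map_replicate, List.sum_replicate,
        List.length_cons, List.length_replicate, hWlen, smul_eq_mul, Nat.succ_eq_add_one,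
        Nat.add_sub_cancel]
      ring
    refine main (G.map (fun a => (a, true)) ++ P₂.map fun a => (a, false)) ?_ (Or.inr ?_)
    · rw [List.map_cons, List.map_append, hfst, hfst, run_cons_some, hy₁, run_append, hG, hP₂]
    · rw [hbeta, List.map_append, hmark, hmark, run_cons_some, hp, run_append]
      change run δ (run δ (some p) (List.replicate G.length α)) P₂ = some q'
      rw [hGlen, hper' _ _ le_rfl, hp', hP₂]

end Core
end AutomaticAlgebra

/-! ### Substituting a letter along a closed walk -/

namespace AutomaticAlgebra

variable {Q : Type u} {S : Type v} {δ : Q → S → Option Q}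

namespace Core

variable {Γ : Set S} {C : Set Q}

/-- The letters written by a substitutable letter: `inl a` is always read as `a`, while `inr b` is
read as `c` at the marked coordinates and as `b` elsewhere. -/
def markedLetter {A B : Set S} (c : S) : A ⊕ B → S := Sum.elim (fun a => a.1) fun _ => c

/-- The letter that a substitutable letter is read as at the coordinates that are not marked. -/
def plainLetter {A B : Set S} : A ⊕ B → S := Sum.elim (fun a => a.1) fun b => b.1

/-- Marked, the word `F` repeats `v` and loops at `q`. Unmarked, `F₀` reads `d` for `c` and leaves
`C`, then `F₁` reads every letter except `c`; the state `g` reached is fixed by unmarked `F` and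
killed by `c`. The word `O` is `F` in four colours, and only the absence of the ghost is left as a
hypothesis. -/
theorem false_of_substitution [Finite Q] [Finite S] (hc : Core δ Γ C) {c : S} (hcΓ : c ∈ Γ)
    {A : Set S} (hA : A ⊆ Γ \ {c}) {q : Q} (hq : q ∈ C) (hqT : Total δ q (Γ \ {c}))
    {v : List S} (hv : ∀ a ∈ v, a = c ∨ a ∈ A) (hcv : c ∈ v) (hvq : run δ (some q) v = some q)
    {sb : S → S} {d : S} (hd : d ∈ Γ \ {c}) (hsc : sb c = d) (hsa : ∀ a ∈ A, sb a = a) {k : ℕ}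
    (hk : ∀ z ∈ C, run δ (some q) (List.replicate k (v.map sb)).flatten ≠ some z)
    (hGA : ∀ g, g ∉ C → δ g c = none → ∀ W : List ((A ⊕ ↥(Γ \ {c})) × ℕ),
      run δ (some q) (W.map fun x => markedLetter c x.1) = some q →
      ∃ i : ℕ, run δ (some q) (W.map (read plainLetter (markedLetter c) fun j => decide (j = i))) ≠
        some g) : False := by
  classical
  let B := Γ \ {c}
  let T := A ⊕ B
  let gen : T → S := plainLetter
  let col : T → S := markedLetter c
  let put : B → S → T := fun b a => if h : a ∈ A then Sum.inl ⟨a, h⟩ else Sum.inr b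
  have hgenB : ∀ τ : T, gen τ ∈ B := by
    rintro (a | b)
    exacts [hA a.2, b.2]
  have hcolput : ∀ b, ∀ a ∈ v, col (put b a) = a := by
    intro b a ha
    by_cases h : a ∈ A
    · simp [put, h, col, markedLetter]
    · obtain rfl := (hv a ha).resolve_right h
      simp [put, h, col, markedLetter]
  have hcA : c ∉ A := fun h => (hA h).2 rfl
  have hgenput : ∀ b : B, gen (put b c) = b.1 := by
    intro b
    simp [put, hcA, gen, plainLetter]
  have hgensub : ∀ a ∈ v, gen (put ⟨d, hd⟩ a) = sb a := by
    intro a ha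
    by_cases h : a ∈ A
    · simp [put, h, gen, plainLetter, hsa a h]
    · obtain rfl := (hv a ha).resolve_right h
      rw [hgenput, hsc]
  obtain ⟨l, hl⟩ := exists_list_mem_iff (Set.univ : Set B)
  set F₀ : List T := (List.replicate k (v.map (put ⟨d, hd⟩))).flatten with hF₀
  set F₁ : List T := l.flatMap fun b => v.map (put b) with hF₁
  have hcolv : ∀ b, (v.map (put b)).map col = v := by
    intro b
    rw [List.map_map]
    exact (List.map_congr_left (hcolput b)).trans (List.map_id v)
  have hF₀col : run δ (some q) (F₀.map col) = some q := by
    rw [hF₀, List.map_flatten, List.map_replicate, hcolv]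
    exact run_flatten_replicate_loop hvq k
  have hF₁col : run δ (some q) (F₁.map col) = some q := by
    rw [hF₁]
    clear hl
    induction l with
    | nil => rfl
    | cons b l ih => rw [List.flatMap_cons, List.map_append, run_append, hcolv, hvq]; exact ih rfl
  have hF₁gen : ∀ b ∈ B, b ∈ F₁.map gen := by
    intro b hb
    refine List.mem_map.2 ⟨put ⟨b, hb⟩ c, List.mem_flatMap.2 ⟨⟨b, hb⟩, (hl _).2 trivial,
      List.mem_map_of_mem hcv⟩, hgenput _⟩
  have hgenΓ : ∀ (F : List T), ∀ a ∈ F.map gen, a ∈ Γ := by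
    intro F a ha
    obtain ⟨τ, -, rfl⟩ := List.mem_map.1 ha
    exact (hgenB τ).1
  obtain ⟨M, hM, hper⟩ := exists_iterate_add_eq fun o => run δ o ((F₀ ++ F₁).map gen)
  set F : List T := (List.replicate M (F₀ ++ F₁)).flatten with hF
  have hFgen : ∀ o, run δ o (F.map gen) = (fun o => run δ o ((F₀ ++ F₁).map gen))^[M] o := by
    intro o
    rw [hF, List.map_flatten, List.map_replicate, run_flatten_replicate]
  have hFcol : run δ (some q) (F.map col) = some q := by
    rw [hF, List.map_flatten, List.map_replicate]
    exact run_flatten_replicate_loop (by rw [List.map_append, run_append, hF₀col, hF₁col]) M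
  obtain ⟨g, hg⟩ := Option.ne_none_iff_exists'.1 (hqT (F.map gen) (by
    intro a ha
    obtain ⟨τ, -, rfl⟩ := List.mem_map.1 ha
    exact hgenB τ))
  have hgg : run δ (some g) (F.map gen) = some g := by
    rw [← hg, hFgen, hFgen, ← Function.iterate_add_apply, hper M le_rfl]
  obtain ⟨M', hM'⟩ := Nat.exists_eq_succ_of_ne_zero (by omega : M ≠ 0)
  set rest := F₁.map gen ++ ((List.replicate M' (F₀ ++ F₁)).flatten).map gen with hrest
  have hFsplit : F.map gen = F₀.map gen ++ rest := by
    rw [hF, hM', List.replicate_succ, List.flatten_cons, List.map_append, List.map_append,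
      List.append_assoc]
  obtain ⟨z, hz, hzg⟩ := exists_run_of_run_append (hFsplit ▸ hg)
  have hzF : ¬ HasFull δ Γ z := by
    refine hc.not_hasFull q hq _ z (hgenΓ F₀) hz fun hzC => hk z hzC ?_
    rw [← hz, hF₀, List.map_flatten, List.map_replicate, List.map_map]
    congr 3
    exact (List.map_congr_left hgensub).symm
  have hrestΓ : ∀ a ∈ rest, a ∈ Γ := by
    intro a ha
    rcases List.mem_append.1 ha with ha | ha
    exacts [hgenΓ _ a ha, hgenΓ _ a ha]
  have hgF : ¬ HasFull δ Γ g := not_hasFull_of_run hzF hrestΓ hzg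
  have hgC : g ∉ C := fun h => hgF (hc.hasFull g h)
  have hdead : ∀ W : List S, (∀ a ∈ W, a ∈ Γ) → c ∈ W → run δ (some g) W = none := by
    intro W hW hcW
    have := run_eq_none_of_not_hasFull hzF (w := rest ++ W) (by
      intro a
      rw [List.mem_append]
      constructor
      · rintro (h | h)
        exacts [hrestΓ a h, hW a h]
      · intro h
        by_cases hac : a = c
        · exact Or.inr (hac ▸ hcW)
        · exact Or.inl (List.mem_append_left _ (hF₁gen a ⟨h, hac⟩)))
    rwa [run_append, hzg] at this
  have hFcoldead : run δ (some g) (F.map col) = none := by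
    apply hdead
    · intro a ha
      obtain ⟨τ, -, rfl⟩ := List.mem_map.1 ha
      rcases τ with a | b
      exacts [(hA a.2).1, hcΓ]
    · have h1 : put ⟨d, hd⟩ c ∈ F₁ := List.mem_flatMap.2 ⟨⟨d, hd⟩, (hl _).2 trivial,
        List.mem_map_of_mem hcv⟩
      have h2 : put ⟨d, hd⟩ c ∈ F := by
        rw [hF, hM', List.replicate_succ, List.flatten_cons]
        exact List.mem_append_left _ (List.mem_append_right _ h1)
      exact List.mem_map.2 ⟨_, h2, hcolput _ c hcv⟩
  let O : List (T × Fin 4) := (F.map fun τ => (τ, 0)) ++ (F.map fun τ => (τ, 1)) ++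
    (F.map fun τ => (τ, 2)) ++ F.map fun τ => (τ, 3)
  have hO : ∀ f, run δ (some q) (O.map (read gen col f)) =
      run δ (run δ (run δ (run δ (some q) (bif f 0 then F.map col else F.map gen))
        (bif f 1 then F.map col else F.map gen)) (bif f 2 then F.map col else F.map gen))
        (bif f 3 then F.map col else F.map gen) := by
    intro f
    simp only [O, List.map_append, map_read_mark, run_append]
  have hfst : ∀ (h : T → S) (i : Fin 4), (F.map fun τ => (τ, i)).map (fun x => h x.1) =
      F.map h := fun h i => by rw [List.map_map]; rfl
  refine hc.not_inherent (inherentlyNonDualizable_of_colours δ (T := T) col gen col q q q g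
    (hGA g hgC (hdead [c] (by simpa using hcΓ) (by simp))) O ?_ ?_ ?_ ?_ ?_ ?_ (Or.inr ?_) F hFcol
    hgg hFcoldead)
  · simp only [O, List.map_append, hfst, run_append, hFcol]
  · simp only [O, List.map_append, hfst, run_append, hg, hgg]
  all_goals
    rw [hO]
    simp [hFcol, hg, hgg, hFcoldead]

/-- Substitution along a closed walk that misses some letter of `Γ`. -/
theorem false_of_proper_walk [Finite Q] [Finite S] (hc : Core δ Γ C) {c : S} (hcΓ : c ∈ Γ)
    {q : Q} (hq : q ∈ C) (hqT : Total δ q (Γ \ {c})) {v : List S} (hv : ∀ a ∈ v, a ∈ Γ)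
    (hproper : ∃ e ∈ Γ, e ∉ v) (hcv : c ∈ v) (hvq : run δ (some q) v = some q)
    {sb : S → S} {d : S} (hd : d ∈ Γ \ {c}) (hsc : sb c = d) (hsa : ∀ a, a ≠ c → sb a = a) {k : ℕ}
    (hk : ∀ z ∈ C, run δ (some q) (List.replicate k (v.map sb)).flatten ≠ some z) : False := by
  classical
  refine hc.false_of_substitution hcΓ (A := {a | a ∈ v ∧ a ≠ c}) (fun a ha => ⟨hv a ha.1, ha.2⟩)
    hq hqT (fun a ha => ?_) hcv hvq hd hsc (fun a ha => hsa a ha.2) hk ?_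
  · by_cases h : a = c
    exacts [Or.inl h, Or.inr ⟨ha, h⟩]
  intro g hgC hgc W hW
  by_contra hcon
  push Not at hcon
  have key : ∀ W : List (({a | a ∈ v ∧ a ≠ c} ⊕ ↥(Γ \ {c})) × ℕ),
      (∀ x ∈ W, x.1.isLeft) ∨ ∃ W₁ b i W₂, W = W₁ ++ (Sum.inr b, i) :: W₂ ∧
        ∀ x ∈ W₂, x.1.isLeft := by
    intro W
    induction W with
    | nil => left; simp
    | cons x W ih =>
      rcases ih with h | ⟨W₁, b, i, W₂, rfl, h⟩
      · obtain ⟨a | b, i⟩ := x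
        · left
          intro y hy
          rcases List.mem_cons.1 hy with rfl | hy
          exacts [rfl, h y hy]
        · exact Or.inr ⟨[], b, i, W, rfl, h⟩
      · exact Or.inr ⟨x :: W₁, b, i, W₂, rfl, h⟩
  have hleft : ∀ W : List (({a | a ∈ v ∧ a ≠ c} ⊕ ↥(Γ \ {c})) × ℕ), (∀ x ∈ W, x.1.isLeft) →
      ∀ i : ℕ, W.map (read plainLetter (markedLetter c) fun j => decide (j = i)) =
        W.map fun x => markedLetter c x.1 := by
    intro W h i
    refine List.map_congr_left ?_
    rintro ⟨a | b, j⟩ hx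
    · simp [read, plainLetter, markedLetter]
    · simpa using h _ hx
  -- At the colour of the last substitutable letter, everything from there on is a word in the
  -- letters of `v`. It misses a letter of `Γ`, so the `c` at its head could be read again at `g`.
  rcases key W with h | ⟨W₁, b, i, W₂, rfl, h⟩
  · have := hcon 0
    rw [hleft W h, hW] at this
    exact hgC (Option.some_injective _ this ▸ hq)
  · have hi := hcon i
    rw [List.map_append, List.map_cons, hleft W₂ h] at hi
    obtain ⟨x, -, hx⟩ := exists_run_of_run_append hi
    have hr : read plainLetter (markedLetter c) (fun j => decide (j = i))
        ((Sum.inr b, i) : ({a | a ∈ v ∧ a ≠ c} ⊕ ↥(Γ \ {c})) × ℕ) = c := by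
      simp [read, markedLetter]
    rw [hr] at hx
    set t := W₂.map fun x => markedLetter c x.1 with ht
    have htv : ∀ a ∈ c :: t, a ∈ v := by
      intro a ha
      rcases List.mem_cons.1 ha with rfl | ha
      · exact hcv
      · obtain ⟨⟨a | b, j⟩, hy, rfl⟩ := List.mem_map.1 ha
        · exact a.2.1
        · simpa using h _ hy
    obtain ⟨e, heΓ, hev⟩ := hproper
    have := hc.total_of_run x (c :: t) (fun a ha => hv a (htv a ha)) ⟨e, heΓ, fun h => hev (htv e h)⟩
      (by simp [hx]) ((c :: t) ++ [c]) (by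
        intro a ha
        rcases List.mem_append.1 ha with ha | ha
        · exact ha
        · simp [List.mem_singleton.1 ha])
    rw [run_append, hx] at this
    exact this hgc

/-- Substitution along a closed walk, where the first letter of the walk is the only one that does
not leave `C`. -/
theorem false_of_unique_next [Finite Q] [Finite S] (hc : Core δ Γ C) {c : S} (hcΓ : c ∈ Γ)
    {q : Q} (hq : q ∈ C) (hqT : Total δ q (Γ \ {c})) {v : List S} (hv : ∀ a ∈ v, a ∈ Γ)
    (hcv : c ∈ v) (hvq : run δ (some q) v = some q)
    (hexit : ∀ b ∈ Γ \ {c}, ∀ z ∈ C, δ q b ≠ some z)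
    {sb : S → S} {d : S} (hd : d ∈ Γ \ {c}) (hsc : sb c = d) (hsa : ∀ a, a ≠ c → sb a = a) {k : ℕ}
    (hk : ∀ z ∈ C, run δ (some q) (List.replicate k (v.map sb)).flatten ≠ some z) : False := by
  classical
  refine hc.false_of_substitution hcΓ (A := Γ \ {c}) subset_rfl
    hq hqT (fun a ha => ?_) hcv hvq hd hsc (fun a ha => hsa a ha.2) hk ?_
  · by_cases h : a = c
    exacts [Or.inl h, Or.inr ⟨hv a ha, h⟩]
  intro g hgC hgc W hW
  by_contra hcon
  push Not at hcon
  have hmΓ : ∀ τ : ↥(Γ \ {c}) ⊕ ↥(Γ \ {c}), markedLetter c τ ∈ Γ := by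
    rintro (a | b)
    exacts [a.2.1, hcΓ]
  have hpΓ : ∀ τ : ↥(Γ \ {c}) ⊕ ↥(Γ \ {c}), plainLetter τ ∈ Γ := by
    rintro (a | b)
    exacts [a.2.1, b.2.1]
  have hrΓ : ∀ (f : ℕ → Bool) (x : (↥(Γ \ {c}) ⊕ ↥(Γ \ {c})) × ℕ),
      read plainLetter (markedLetter c) f x ∈ Γ := by
    intro f x
    simp only [read]
    cases f x.2
    exacts [hpΓ _, hmΓ _]
  cases W with
  | nil => exact hgC (Option.some_injective _ (hcon 0) ▸ hq)
  | cons x W =>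
    rw [List.map_cons] at hW
    obtain ⟨y, hy, hqy, -⟩ := hc.mem_of_run_append (w := [markedLetter c x.1]) hq
      (by simpa using hmΓ x.1) (by
        intro a ha
        obtain ⟨x, -, rfl⟩ := List.mem_map.1 ha
        exact hmΓ _) hW hq
    obtain ⟨a | b, i⟩ := x
    · exact hexit a.1 a.2 y hy hqy
    -- With a single colour, that coordinate copies the control and ends at `q`. Otherwise, at a
    -- second colour `j`, the first letter leaves `C` and a later one is `c`, so `g` would read `c`.
    · by_cases hall : ∀ x ∈ W, x.1.isRight → x.2 = i
      · have : ((Sum.inr b, i) :: W).map (read plainLetter (markedLetter c) fun j => decide (j = i)) =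
            ((Sum.inr b, i) :: W).map fun x => markedLetter c x.1 := by
          refine List.map_congr_left ?_
          rintro ⟨a' | b', j⟩ hx
          · simp [read, plainLetter, markedLetter]
          · have : j = i := by
              rcases List.mem_cons.1 hx with h | h
              · simpa using congrArg Prod.snd h
              · exact hall _ h rfl
            simp [read, this]
        have h := hcon i
        rw [this, List.map_cons, hW] at h
        exact hgC (Option.some_injective _ h ▸ hq)
      · push Not at hall
        obtain ⟨⟨a' | b', j⟩, hx, hxr, hxi⟩ := hall
        · simp at hxr
        have h := hcon j
        have hr : read plainLetter (markedLetter c) (fun m => decide (m = j))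
            ((Sum.inr b, i) : (↥(Γ \ {c}) ⊕ ↥(Γ \ {c})) × ℕ) = b.1 := by
          simp only [read, Ne.symm hxi, decide_false]
          rfl
        rw [List.map_cons, hr] at h
        obtain ⟨z, hz, hzg⟩ := exists_run_of_run_cons h
        refine hc.next_ne_none (a := c) (hc.not_hasFull q hq [b.1] z (by simpa using b.2.1) hz
          fun hzC => hexit b.1 b.2 z hzC hz) (fun a ha => ?_) ?_ hzg hgc
        · obtain ⟨x, -, rfl⟩ := List.mem_map.1 ha
          exact hrΓ _ _
        · exact List.mem_map.2 ⟨_, hx, by simp [read, markedLetter]⟩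

end Core
end AutomaticAlgebra

/-! ### Edges inside a core -/

theorem List.exists_last_not {α : Type*} {l : List α} {p : α → Prop} {a : α} (ha : a ∈ l)
    (hp : ¬ p a) : ∃ l₁ b l₂, l = l₁ ++ b :: l₂ ∧ ¬ p b ∧ ∀ c ∈ l₂, p c := by
  induction l generalizing a with
  | nil => simp at ha
  | cons c l ih =>
    by_cases h : ∀ b ∈ l, p b
    · rcases List.mem_cons.1 ha with rfl | ha
      exacts [⟨[], a, l, rfl, hp, h⟩, absurd (h a ha) hp]
    · push Not at h
      obtain ⟨b, hb, hpb⟩ := h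
      obtain ⟨l₁, b, l₂, rfl, h1, h2⟩ := ih hb hpb
      exact ⟨c :: l₁, b, l₂, rfl, h1, h2⟩

namespace AutomaticAlgebra

variable {Q : Type u} {S : Type v} {δ : Q → S → Option Q}

/-- Some transition inside `C` is labelled by `a`. -/
def HasEdge (δ : Q → S → Option Q) (C : Set Q) (a : S) : Prop := ∃ p ∈ C, ∃ p' ∈ C, δ p a = some p'

theorem exists_cycle_of_forall_mem [Finite Q] {C : Set Q} {q : Q} {w : List S}
    (h : ∀ k, ∃ z ∈ C, run δ (some q) (List.replicate k w).flatten = some z) :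
    ∃ z ∈ C, ∃ n > 0, run δ (some z) (List.replicate n w).flatten = some z := by
  choose f hf hqf using h
  obtain ⟨i, j, hij, hfij⟩ : ∃ i j : ℕ, i < j ∧ f i = f j := by
    obtain ⟨i, j, hne, h⟩ := Finite.exists_ne_map_eq_of_infinite f
    rcases lt_or_gt_of_ne hne with hlt | hlt
    exacts [⟨i, j, hlt, h⟩, ⟨j, i, hlt, h.symm⟩]
  refine ⟨f i, hf i, j - i, by omega, ?_⟩
  have := hqf j
  rw [show j = i + (j - i) by omega, List.replicate_add, List.flatten_append, run_append, hqf i,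
    show i + (j - i) = j by omega] at this
  rw [this, hfij]

theorem flatten_replicate_singleton (n : ℕ) (a : S) :
    (List.replicate n [a]).flatten = List.replicate n a := by
  induction n with
  | zero => rfl
  | succ n ih => rw [List.replicate_succ, List.replicate_succ, List.flatten_cons, ih]; rfl

theorem mem_of_mem_flatten_replicate {n : ℕ} {w : List S} {a : S}
    (h : a ∈ (List.replicate n w).flatten) : a ∈ w := by
  obtain ⟨l, hl, ha⟩ := List.mem_flatten.1 h
  exact List.eq_of_mem_replicate hl ▸ ha

namespace Core

variable {Γ : Set S} {C : Set Q}

theorem hasEdge_of_run (hc : Core δ Γ C) {x y : Q} {w : List S} (hx : x ∈ C) (hw : ∀ a ∈ w, a ∈ Γ)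
    (h : run δ (some x) w = some y) (hy : y ∈ C) {a : S} (ha : a ∈ w) : HasEdge δ C a := by
  obtain ⟨w₁, w₂, rfl⟩ := List.append_of_mem ha
  obtain ⟨p, hp, -, h⟩ := hc.mem_of_run_append hx (fun b hb => hw b (by simp [hb]))
    (fun b hb => hw b (by simp at hb ⊢; tauto)) h hy
  obtain ⟨p', hp', hpp', -⟩ := hc.mem_of_run_append (w := [a]) hp (fun b hb => hw b (by simp_all))
    (fun b hb => hw b (by simp [hb])) h hy
  exact ⟨p, hp, p', hp', hpp'⟩

theorem exists_exit {x y : Q} {w : List S} (hx : x ∈ C) (h : run δ (some x) w = some y)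
    (hy : y ∉ C) : ∃ w₁ e w₂, w = w₁ ++ e :: w₂ ∧ ∃ x₁ ∈ C, run δ (some x) w₁ = some x₁ ∧
      ∃ z ∉ C, δ x₁ e = some z ∧ run δ (some z) w₂ = some y := by
  induction w generalizing x with
  | nil =>
    obtain rfl : x = y := by simpa using h
    exact absurd hx hy
  | cons a w ih =>
    obtain ⟨z, hz, hzy⟩ := exists_run_of_run_cons h
    by_cases hzC : z ∈ C
    · obtain ⟨w₁, e, w₂, rfl, x₁, hx₁, hzx₁, hrest⟩ := ih hzC hzy
      refine ⟨a :: w₁, e, w₂, rfl, x₁, hx₁, ?_, hrest⟩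
      rw [run_cons_some, hz, hzx₁]
    · exact ⟨[], a, w, rfl, x, hx, rfl, z, hzC, hz, hzy⟩

/-- The word `w` followed by a list of `Δ` is readable and misses a letter of `Γ`, so minimality of
`Γ` applies to it. -/
theorem total_append [Finite S] (hc : Core δ Γ C) {x y : Q} {w : List S} {Δ : Set S}
    (hw : ∀ a ∈ w, a ∈ Γ) (hΔ : Δ ⊆ Γ) (hproper : ∃ e ∈ Γ, e ∉ w ∧ e ∉ Δ)
    (h : run δ (some x) w = some y) (hy : Total δ y Δ) : Total δ x ({a | a ∈ w} ∪ Δ) := by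
  obtain ⟨l, hl⟩ := exists_list_mem_iff Δ
  obtain ⟨e, he, hew, heΔ⟩ := hproper
  refine (hc.total_of_run x (w ++ l) (fun a ha => ?_) ⟨e, he, ?_⟩ ?_).mono ?_
  · rcases List.mem_append.1 ha with ha | ha
    exacts [hw a ha, hΔ ((hl a).1 ha)]
  · rw [List.mem_append, hl]
    tauto
  · rw [run_append, h]
    exact hy l fun a ha => (hl a).1 ha
  · rintro a (ha | ha)
    exacts [List.mem_append_left _ ha, List.mem_append_right _ ((hl a).2 ha)]

/-- A readable full word contains `c` and so must leave `C`, by some edge `e`. If the part from `e`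
on misses a letter, its letter set is enlarged to a maximal one; if not, the state before the exit
already works. -/
theorem exists_total_diff_of_not_hasEdge [Finite S] (hc : Core δ Γ C) {c : S} (hc₀ : c ∈ Γ)
    (hcE : ¬ HasEdge δ C c) :
    ∃ y ∈ C, ∃ l ∈ Γ, HasEdge δ C l ∧ Total δ y (Γ \ {l}) := by
  obtain ⟨x, hx⟩ := hc.nonempty
  obtain ⟨w, hw, halive⟩ := hc.hasFull x hx
  obtain ⟨g, hg⟩ := Option.ne_none_iff_exists'.1 halive
  have hwΓ : ∀ a ∈ w, a ∈ Γ := fun a ha => (hw a).1 ha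
  have hgC : g ∉ C := fun h => hcE (hc.hasEdge_of_run hx hwΓ hg h ((hw c).2 hc₀))
  obtain ⟨w₁, e, w₂, rfl, x₁, hx₁, hxx₁, z, hzC, hz, hzg⟩ := exists_exit hx hg hgC
  have heΓ : e ∈ Γ := hwΓ e (by simp)
  have hw₂ : ∀ a ∈ w₂, a ∈ Γ := fun a ha => hwΓ a (by simp [ha])
  have hzF := hc.not_hasFull x₁ hx₁ [e] z (by simpa using heΓ) hz hzC
  by_cases hproper : ∃ d ∈ Γ, d ∉ e :: w₂
  · obtain ⟨Θ, hΘ⟩ := (Set.toFinite {Θ : Set S | Θ ⊆ Γ ∧ (∃ d ∈ Γ, d ∉ Θ) ∧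
      (∃ y ∈ C, Total δ y Θ) ∧ ∀ d ∈ Γ, d ∉ Θ → HasEdge δ C d}).exists_maximal
      ⟨{a | a ∈ e :: w₂}, fun a ha => hwΓ a (List.mem_append_right _ ha), hproper,
        ⟨x₁, hx₁, hc.total_of_run x₁ _ (fun a ha => hwΓ a (List.mem_append_right _ ha)) hproper
          (by rw [run_cons_some, hz, hzg]; simp)⟩, fun d hd hde => by
          refine hc.hasEdge_of_run hx (fun a ha => hwΓ a (by simp [ha])) hxx₁ hx₁ (a := d) ?_
          exact (List.mem_append.1 ((hw d).2 hd)).resolve_right hde⟩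
    obtain ⟨hΘΓ, ⟨l, hlΓ, hlΘ⟩, ⟨y, hy, hyT⟩, hΘE⟩ := hΘ.prop
    by_cases honly : ∀ d ∈ Γ, d ∉ Θ → d = l
    · refine ⟨y, hy, l, hlΓ, hΘE l hlΓ hlΘ, hyT.mono ?_⟩
      rintro a ⟨ha, hal⟩
      by_contra h
      exact hal (honly a ha h)
    · exfalso
      push Not at honly
      obtain ⟨d, hdΓ, hdΘ, hdl⟩ := honly
      obtain ⟨p, hp, p', hp', hpp'⟩ := hΘE l hlΓ hlΘ
      obtain ⟨r, hr, hp'y⟩ := hc.connected p' hp' y hy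
      have hpy : run δ (some p) (l :: r) = some y := by rw [run_cons_some, hpp', hp'y]
      have hlr : ∀ a ∈ l :: r, a ∈ Γ := by simpa using ⟨hlΓ, hr⟩
      -- If two letters remain outside `Θ`, the state before the last letter outside `Θ` on a walk
      -- to `y` is total for `Θ` and that letter, against maximality.
      obtain ⟨r₁, b, r₂, hsplit, hb, hr₂⟩ :=
        List.exists_last_not (p := (· ∈ Θ)) (List.mem_cons_self (a := l) (l := r)) hlΘ
      rw [hsplit] at hpy hlr
      obtain ⟨y₁, hy₁, -, hy₁y⟩ := hc.mem_of_run_append hp (fun a ha => hlr a (by simp [ha]))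
        (fun a ha => hlr a (List.mem_append_right _ ha)) hpy hy
      have hbΓ : b ∈ Γ := hlr b (by simp)
      obtain ⟨e', he'Γ, he'Θ, he'b⟩ : ∃ e' ∈ Γ, e' ∉ Θ ∧ e' ≠ b := by
        by_cases h : l = b
        exacts [⟨d, hdΓ, hdΘ, h ▸ hdl⟩, ⟨l, hlΓ, hlΘ, h⟩]
      have hT := hc.total_append (fun a ha => hlr a (List.mem_append_right _ ha)) hΘΓ
        ⟨e', he'Γ, fun h => (List.mem_cons.1 h).elim he'b fun h => he'Θ (hr₂ _ h), he'Θ⟩ hy₁y hyT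
      refine hb (hΘ.le_of_ge (y := insert b Θ) ⟨?_, ⟨e', he'Γ, ?_⟩, ⟨y₁, hy₁, hT.mono ?_⟩, ?_⟩
        (Set.subset_insert _ _) (Set.mem_insert _ _))
      · exact Set.insert_subset hbΓ hΘΓ
      · rintro (h | h)
        exacts [he'b h, he'Θ h]
      · rintro a (rfl | h)
        exacts [Or.inl (by simp), Or.inr h]
      · exact fun d hd hdΘ => hΘE d hd fun h => hdΘ (Set.mem_insert_of_mem _ h)
  · push Not at hproper
    have hew₂ : e ∉ w₂ := by
      intro he
      have := run_eq_none_of_not_hasFull hzF (w := w₂) fun a =>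
        ⟨hw₂ a, fun ha => (List.mem_cons.1 (hproper a ha)).elim (fun h => h ▸ he) id⟩
      rw [hzg] at this
      simp at this
    obtain ⟨l, hlΓ, x', hx', hxx'⟩ := hc.exists_next_mem hx₁
    have hle : l ≠ e := by
      rintro rfl
      rw [hz] at hxx'
      exact hzC (Option.some_injective _ hxx' ▸ hx')
    refine ⟨x₁, hx₁, l, hlΓ, ⟨x₁, hx₁, x', hx', hxx'⟩, ?_⟩
    refine (hc.total_append (w := [e]) (Δ := (Γ \ {e}) \ {l}) (by simpa using heΓ)
      (Set.sdiff_subset.trans Set.sdiff_subset) ⟨l, hlΓ, by simpa using hle, by simp⟩ hz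
      ((hc.total_of_not_hasFull hzF hw₂ (by simp [hzg])).mono ?_)).mono ?_
    · rintro a ⟨⟨ha, hae⟩, -⟩
      exact (List.mem_cons.1 (hproper a ha)).resolve_left hae
    · rintro a ⟨ha, hal⟩
      by_cases h : a = e
      · exact Or.inl (by simp [h])
      · exact Or.inr ⟨⟨ha, h⟩, hal⟩

/-- A closed walk through `l` never uses `c`; substituting `c` for `l` therefore takes it out of `C`
in one round. -/
theorem hasEdge [Finite Q] [Finite S] (hc : Core δ Γ C) {c : S} (hcΓ : c ∈ Γ) : HasEdge δ C c := by
  classical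
  by_contra hcE
  obtain ⟨y, hy, l, hlΓ, ⟨p, hp, p', hp', hpp'⟩, hT⟩ :=
    hc.exists_total_diff_of_not_hasEdge hcΓ hcE
  obtain ⟨r₁, hr₁, hyp⟩ := hc.connected y hy p hp
  obtain ⟨r₂, hr₂, hp'y⟩ := hc.connected p' hp' y hy
  have hlc : l ≠ c := by
    rintro rfl
    exact hcE ⟨p, hp, p', hp', hpp'⟩
  have hv : ∀ a ∈ r₁ ++ l :: r₂, a ∈ Γ := by
    intro a ha
    rcases List.mem_append.1 ha with ha | ha
    · exact hr₁ a ha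
    · rcases List.mem_cons.1 ha with rfl | ha
      exacts [hlΓ, hr₂ a ha]
  have hloop : run δ (some y) (r₁ ++ l :: r₂) = some y := by
    rw [run_append, hyp, run_cons_some, hpp', hp'y]
  refine hc.false_of_proper_walk hlΓ hy hT hv
    ⟨c, hcΓ, fun h => hcE (hc.hasEdge_of_run hy hv hloop hy h)⟩ (by simp) hloop
    (sb := fun a => if a = l then c else a) (d := c) ⟨hcΓ, Ne.symm hlc⟩ (if_pos rfl)
    (fun a ha => if_neg ha) (k := 1) ?_
  intro z hz h
  refine hcE (hc.hasEdge_of_run hy ?_ h hz (a := c) ?_)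
  · intro a ha
    obtain ⟨b, hb, rfl⟩ := List.mem_map.1 (mem_of_mem_flatten_replicate ha)
    split
    exacts [hcΓ, hv b hb]
  · simp

/-- By induction on `Δ`: an inner edge labelled by the new letter gives one total state, and
totality is carried back along walks in `C`. Each step prefixes one letter, so one of `d` and `e` is
still missing. -/
theorem total_of_two_notMem [Finite Q] [Finite S] (hc : Core δ Γ C) {Δ : Set S} {d e : S}
    (hd : d ∈ Γ) (he : e ∈ Γ) (hde : d ≠ e) (hΔ : Δ ⊆ Γ) (hdΔ : d ∉ Δ) (heΔ : e ∉ Δ) :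
    ∀ x ∈ C, Total δ x Δ := by
  induction Δ, Set.toFinite Δ using Set.Finite.induction_on with
  | empty =>
    intro x _ w hw
    cases w with
    | nil => simp
    | cons a w => exact absurd (hw a (by simp)) (by simp)
  | @insert a Δ _ _ ih =>
    have haΓ : a ∈ Γ := hΔ (Set.mem_insert _ _)
    have hΔ' : Δ ⊆ Γ := (Set.subset_insert _ _).trans hΔ
    obtain ⟨p, hp, p', hp', hpp'⟩ := hc.hasEdge haΓ
    simp only [Set.mem_insert_iff, not_or] at hdΔ heΔ
    have hpT : Total δ p (insert a Δ) :=
      (hc.total_append (w := [a]) (by simpa using haΓ) hΔ' ⟨d, hd, by simpa using hdΔ.1, hdΔ.2⟩ hpp'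
        (ih hΔ' hdΔ.2 heΔ.2 p' hp')).mono (by
          rintro b (rfl | hb)
          exacts [Or.inl (by simp), Or.inr hb])
    have key : ∀ (w : List S), (∀ b ∈ w, b ∈ Γ) → ∀ x, run δ (some x) w = some p →
        Total δ x (insert a Δ) := by
      intro w
      induction w with
      | nil =>
        intro _ x h
        obtain rfl : x = p := by simpa using h
        exact hpT
      | cons b w ihw =>
        intro hw x h
        obtain ⟨z, hz, hzp⟩ := exists_run_of_run_cons h
        refine (hc.total_append (w := [b]) (by simpa using hw b (by simp)) hΔ ?_ hz
          (ihw (fun c hc => hw c (by simp [hc])) z hzp)).mono Set.subset_union_right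
        by_cases hdb : d = b
        · exact ⟨e, he, by simpa [← hdb] using hde.symm, by simpa using heΔ⟩
        · exact ⟨d, hd, by simpa using hdb, by simpa using hdΔ⟩
    intro x hx
    obtain ⟨w, hw, h⟩ := hc.connected x hx p hp
    exact key w hw x h

theorem total_diff_of_next [Finite Q] [Finite S] (hc : Core δ Γ C) {x y : Q} {a c : S} (ha : a ∈ Γ)
    (hcΓ : c ∈ Γ) (hac : a ≠ c) (hy : y ∈ C) (h : δ x a = some y) : Total δ x (Γ \ {c}) := by
  refine (hc.total_append (w := [a]) (Δ := (Γ \ {c}) \ {a}) (by simpa using ha)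
    (Set.sdiff_subset.trans Set.sdiff_subset) ⟨c, hcΓ, by simpa using hac.symm, by simp⟩ h
    (hc.total_of_two_notMem ha hcΓ hac (Set.sdiff_subset.trans Set.sdiff_subset) (by simp) (by simp)
      y hy)).mono ?_
  intro b hb
  by_cases h : b = a
  exacts [Or.inl (by simp [h]), Or.inr ⟨hb, h⟩]

end Core
end AutomaticAlgebra

/-! ### Minimal letter sets of closed walks -/

namespace AutomaticAlgebra

variable {Q : Type u} {S : Type v} {δ : Q → S → Option Q}

namespace Core

variable {Γ : Set S} {C : Set Q}

/-- `V` is the set of letters of a non-empty closed walk inside `C`. -/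
def IsCycleSet (δ : Q → S → Option Q) (Γ : Set S) (C : Set Q) (V : Set S) : Prop :=
  ∃ x ∈ C, ∃ v : List S, v ≠ [] ∧ (∀ a ∈ v, a ∈ Γ) ∧ run δ (some x) v = some x ∧
    ∀ a, a ∈ V ↔ a ∈ v

/-- If every power of `u` kept the walk in `C`, finiteness would give a closed walk with letters in
`V` other than `l`, against minimality. -/
theorem exists_leave [Finite Q] {V : Set S}
    (hV : ∀ V', IsCycleSet δ Γ C V' → V' ⊆ V → V ⊆ V') {l : S} (hl : l ∈ V) (hVΓ : V ⊆ Γ) (q : Q)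
    {u : List S} (hu : u ≠ []) (huV : ∀ a ∈ u, a ∈ V ∧ a ≠ l) :
    ∃ k, ∀ z ∈ C, run δ (some q) (List.replicate k u).flatten ≠ some z := by
  by_contra hcon
  push Not at hcon
  obtain ⟨z, hz, n, hn, hloop⟩ := exists_cycle_of_forall_mem hcon
  have hsub : ∀ a ∈ (List.replicate n u).flatten, a ∈ V ∧ a ≠ l := fun a ha =>
    huV a (mem_of_mem_flatten_replicate ha)
  have hne : (List.replicate n u).flatten ≠ [] := by
    obtain ⟨m, rfl⟩ := Nat.exists_eq_succ_of_ne_zero hn.ne'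
    rw [List.replicate_succ, List.flatten_cons]
    simp [hu]
  have := hV {a | a ∈ (List.replicate n u).flatten}
    ⟨z, hz, _, hne, fun a ha => hVΓ (hsub a ha).1, hloop, fun _ => Iff.rfl⟩
    (fun a ha => (hsub a ha).1) hl
  exact (hsub l this).2 rfl

theorem false_of_two_le [Finite Q] [Finite S] (hc : Core δ Γ C) {V : Set S}
    (hV : IsCycleSet δ Γ C V) (hmin : ∀ V', IsCycleSet δ Γ C V' → V' ⊆ V → V ⊆ V')
    {l d : S} (hl : l ∈ V) (hd : d ∈ V) (hld : l ≠ d) {e : S} (heΓ : e ∈ Γ) (heV : e ∉ V) :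
    False := by
  classical
  obtain ⟨x, hx, v, -, hvΓ, hloop, hVv⟩ := hV
  obtain ⟨v₁, v₂, rfl⟩ := List.append_of_mem ((hVv d).1 hd)
  have hVΓ : V ⊆ Γ := fun a ha => hvΓ a ((hVv a).1 ha)
  obtain ⟨q, hq, hxq, hqx⟩ := hc.mem_of_run_append hx (fun b hb => hvΓ b (by simp [hb]))
    (fun b hb => hvΓ b (List.mem_append_right _ hb)) hloop hx
  obtain ⟨y, hy, hqy, -⟩ := hc.mem_of_run_append (w := [d]) hq (by simpa using hVΓ hd)
    (fun b hb => hvΓ b (by simp [hb])) hqx hx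
  have hmem : ∀ a, a ∈ V ↔ a ∈ (d :: v₂) ++ v₁ := fun a => by
    rw [hVv a, List.mem_append, List.mem_append, or_comm]
  have hqloop : run δ (some q) ((d :: v₂) ++ v₁) = some q := by rw [run_append, hqx, hxq]
  obtain ⟨k, hk⟩ := exists_leave hmin hl hVΓ q
    (u := ((d :: v₂) ++ v₁).map fun a => if a = l then d else a) (by simp) (by
      intro a ha
      obtain ⟨b, hb, rfl⟩ := List.mem_map.1 ha
      split
      exacts [⟨hd, hld.symm⟩, ⟨(hmem b).2 hb, by assumption⟩])
  exact hc.false_of_proper_walk (hVΓ hl) hq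
    (hc.total_diff_of_next (hVΓ hd) (hVΓ hl) hld.symm hy hqy) (fun a ha => hVΓ ((hmem a).2 ha))
    ⟨e, heΓ, fun h => heV ((hmem e).2 h)⟩ ((hmem l).1 hl) hqloop
    (sb := fun a => if a = l then d else a) ⟨hVΓ hd, hld.symm⟩ (if_pos rfl)
    (fun a ha => if_neg ha) hk

/-- Among the states of `C` reachable without `l`, one with the fewest such successors has `l` as
its only edge inside `C`: another edge could be reversed without `l`, giving a closed walk that
misses `l`. -/
theorem false_of_full_cycles [Finite Q] [Finite S] (hc : Core δ Γ C)
    (hmin : ∀ V', IsCycleSet δ Γ C V' → V' ⊆ Γ → Γ ⊆ V') : False := by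
  classical
  obtain ⟨x₀, hx₀⟩ := hc.nonempty
  obtain ⟨d, hdΓ, -⟩ := hc.exists_next_mem hx₀
  obtain ⟨l, hlΓ, hld⟩ := hc.exists_ne d
  obtain ⟨x, hx, x', hx', hxx'⟩ := hc.hasEdge hdΓ
  let R : Q → Set Q := fun y => {z | z ∈ C ∧ ∃ w : List S, (∀ a ∈ w, a ∈ Γ \ {l}) ∧
    run δ (some y) w = some z}
  have hRtrans : ∀ y z, z ∈ R y → R z ⊆ R y := by
    rintro y z ⟨-, w, hw, hyz⟩ t ⟨ht, w', hw', hzt⟩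
    refine ⟨ht, w ++ w', fun a ha => ?_, by rw [run_append, hyz, hzt]⟩
    rcases List.mem_append.1 ha with ha | ha
    exacts [hw a ha, hw' a ha]
  have hRrefl : ∀ y ∈ C, y ∈ R y := fun y hy => ⟨hy, [], by simp, rfl⟩
  obtain ⟨q, hqR, hqmin⟩ := Set.exists_min_image (R x) (fun y => (R y).ncard) (Set.toFinite _)
    ⟨x, hRrefl x hx⟩
  obtain ⟨hq, w, hw, hxq⟩ := hqR
  have hqT : Total δ q (Γ \ {l}) :=
    (hc.total_diff_of_next hdΓ hlΓ hld.symm hx' hxx').of_run hw hxq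
  have hexit : ∀ b ∈ Γ \ {l}, ∀ z ∈ C, δ q b ≠ some z := by
    intro b hb z hz hqz
    have hzR : z ∈ R q := ⟨hz, [b], by simpa using hb, hqz⟩
    have heq : R z = R q := Set.eq_of_subset_of_ncard_le (hRtrans _ _ hzR)
      (hqmin z (hRtrans _ _ ⟨hq, w, hw, hxq⟩ hzR)) (Set.toFinite _)
    obtain ⟨-, w', hw', hzq⟩ : q ∈ R z := heq ▸ hRrefl q hq
    have hbw : ∀ a ∈ b :: w', a ∈ Γ \ {l} := by
      intro a ha
      rcases List.mem_cons.1 ha with rfl | ha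
      exacts [hb, hw' a ha]
    have := hmin {a | a ∈ b :: w'} ⟨q, hq, b :: w', by simp, fun a ha => (hbw a ha).1,
      by rw [run_cons_some, hqz, hzq], fun _ => Iff.rfl⟩ (fun a ha => (hbw a ha).1) hlΓ
    exact (hbw l this).2 rfl
  obtain ⟨a, haΓ, y, hy, hqy⟩ := hc.exists_next_mem hq
  obtain rfl : a = l := by
    by_contra h
    exact hexit a ⟨haΓ, h⟩ y hy hqy
  obtain ⟨v, hv, hyq⟩ := hc.connected y hy q hq
  have hav : ∀ b ∈ a :: v, b ∈ Γ := by simpa using ⟨haΓ, hv⟩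
  obtain ⟨k, hk⟩ := exists_leave hmin hlΓ subset_rfl q
    (u := (a :: v).map fun b => if b = a then d else b) (by simp) (by
      intro c hcu
      obtain ⟨b, hb, rfl⟩ := List.mem_map.1 hcu
      split
      exacts [⟨hdΓ, hld.symm⟩, ⟨hav b hb, by assumption⟩])
  exact hc.false_of_unique_next hlΓ hq hqT hav (by simp) (by rw [run_cons_some, hqy, hyq]) hexit
    (sb := fun b => if b = a then d else b) ⟨hdΓ, hld.symm⟩ (if_pos rfl) (fun b hb => if_neg hb) hk

/-- `C` contains a cycle all of whose edges are labelled `a`. -/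
def HasLoop (δ : Q → S → Option Q) (C : Set Q) (a : S) : Prop :=
  ∃ q ∈ C, ∃ n > 0, run δ (some q) (List.replicate n a) = some q

theorem not_total_of_hasLoop [Finite Q] [Finite S] (hc : Core δ Γ C) {b : S} (hb : b ∈ Γ)
    (hloop : HasLoop δ C b) {x z : Q} {e : S} (hx : x ∈ C) (he : e ∈ Γ) (hz : δ x e = some z)
    (hzC : z ∉ C) : ¬ Total δ z (Γ \ {b}) := by
  intro hT
  obtain ⟨q, hq, n, hn, hcyc⟩ := hloop
  obtain ⟨w, hw, hqx⟩ := hc.connected q hq x hx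
  refine hc.false_of_cycle_of_total hb hq hn hcyc (p := w ++ [e]) ?_
    (by rw [run_append, hqx]; exact hz) hzC hT
  intro a ha
  rcases List.mem_append.1 ha with ha | ha
  exacts [hw a ha, by rwa [List.mem_singleton.1 ha]]

theorem hasLoop_of_forall_mem [Finite Q] {q : Q} {b : S}
    (h : ∀ k, ∃ z ∈ C, run δ (some q) (List.replicate k b) = some z) : HasLoop δ C b := by
  obtain ⟨z, hz, n, hn, hloop⟩ := exists_cycle_of_forall_mem (C := C) (q := q) (w := [b]) (by
    simpa only [flatten_replicate_singleton] using h)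
  exact ⟨z, hz, n, hn, by rwa [flatten_replicate_singleton] at hloop⟩

theorem total_single (hc : Core δ Γ C) {x : Q} {a : S} (ha : a ∈ Γ) (h : δ x a ≠ none) :
    Total δ x {a} := by
  obtain ⟨c, hcΓ, hca⟩ := hc.exists_ne a
  exact (hc.total_of_run x [a] (by simpa using ha) ⟨c, hcΓ, by simpa using hca⟩ h).mono (by simp)

theorem hasLoop_of_no_exit [Finite Q] [Finite S] (hc : Core δ Γ C) {a : S} (ha : a ∈ Γ)
    (hno : ∀ x ∈ C, ∀ z, δ x a = some z → z ∈ C) : HasLoop δ C a := by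
  obtain ⟨p, hp, p', hp', hpp'⟩ := hc.hasEdge ha
  refine hasLoop_of_forall_mem (q := p) fun k => ?_
  obtain ⟨z, hz⟩ := Option.ne_none_iff_exists'.1
    (hc.total_single (x := p) ha (by simp [hpp']) (List.replicate k a)
      fun b hb => List.eq_of_mem_replicate hb)
  exact ⟨z, mem_of_closed (Γ := {a}) (by simpa using hno) hp
    (fun b hb => List.eq_of_mem_replicate hb) hz, hz⟩

theorem exists_eq_none_of_closed (hc : Core δ Γ C)
    (hclosed : ∀ x ∈ C, ∀ a ∈ Γ, ∀ z, δ x a = some z → z ∈ C) :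
    ∃ y ∈ C, ∃ a ∈ Γ, δ y a = none := by
  by_contra hcon
  push Not at hcon
  obtain ⟨x, hx⟩ := hc.nonempty
  refine hc.not_total x hx fun w hw => ?_
  induction w generalizing x with
  | nil => simp
  | cons a w ih =>
    obtain ⟨z, hz⟩ := Option.ne_none_iff_exists'.1 (hcon x hx a (hw a (by simp)))
    rw [run_cons_some, hz]
    exact ih z (hclosed x hx a (hw a (by simp)) z hz) fun b hb => hw b (by simp [hb])

theorem exists_exit_edge [Finite Q] [Finite S] (hc : Core δ Γ C) :
    ∃ x ∈ C, ∃ e ∈ Γ, ∃ z ∉ C, δ x e = some z := by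
  by_contra hcon
  have hclosed : ∀ x ∈ C, ∀ a ∈ Γ, ∀ z, δ x a = some z → z ∈ C := by
    intro x hx a ha z hz
    by_contra hzC
    exact hcon ⟨x, hx, a, ha, z, hzC, hz⟩
  obtain ⟨y, hy, a, ha, hya⟩ := hc.exists_eq_none_of_closed hclosed
  obtain ⟨b, hb, y', -, hyb⟩ := hc.exists_next_mem hy
  obtain ⟨q, hq, n, hn, hcyc⟩ := hc.hasLoop_of_no_exit ha fun x hx => hclosed x hx a ha
  exact hc.false_of_closed hclosed ha hb hy hya (by simp [hyb]) hq hn hcyc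

/-- Before its first letter other than `α`, the walk merely moves along the `α`-cycle. -/
theorem exists_loop_state_next_ne (hc : Core δ Γ C) {α : S} (hα : α ∈ Γ) {q p : Q} {n : ℕ}
    (hcyc : run δ (some q) (List.replicate n α) = some q) {w : List S} (hq : q ∈ C)
    (hw : ∀ a ∈ w, a ∈ Γ) (h : run δ (some q) w = some p) (hp : p ∈ C) {c : S} (hcw : c ∈ w)
    (hcα : c ≠ α) : ∃ y ∈ C, run δ (some y) (List.replicate n α) = some y ∧
      ∃ d ∈ Γ, d ≠ α ∧ ∃ y' ∈ C, δ y d = some y' := by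
  induction w generalizing q with
  | nil => simp at hcw
  | cons a w ih =>
    have ha : a ∈ Γ := hw a (by simp)
    have hw' : ∀ b ∈ w, b ∈ Γ := fun b hb => hw b (by simp [hb])
    obtain ⟨y, hy, hqy, hyp⟩ := hc.mem_of_run_append (w := [a]) hq (by simpa using ha) hw' h hp
    by_cases haα : a = α
    · subst haα
      refine ih ?_ hy hw' hyp ((List.mem_cons.1 hcw).resolve_left hcα)
      rw [← hqy, show [a] = List.replicate 1 a from rfl, ← run_replicate_add, add_comm,
        run_replicate_add, hcyc]
    · exact ⟨q, hq, hcyc, a, ha, haα, y, hy, hqy⟩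

/-- A state on the `α`-cycle with another inner edge is total for `Γ \ {α}`. Powers of `b` read
there cannot leave `C` by `false_of_cycle_of_total`, so they eventually cycle. -/
theorem hasLoop_of_hasLoop [Finite Q] [Finite S] (hc : Core δ Γ C) {α b : S} (hα : α ∈ Γ)
    (hb : b ∈ Γ) (hloop : HasLoop δ C α) : HasLoop δ C b := by
  by_cases hbα : b = α
  · rwa [hbα]
  obtain ⟨q, hq, n, hn, hcyc⟩ := hloop
  obtain ⟨p, hp, p', hp', hpp'⟩ := hc.hasEdge hb
  obtain ⟨r, hr, hqp⟩ := hc.connected q hq p hp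
  obtain ⟨y, hy, hycyc, d, hdΓ, hdα, y', hy', hyy'⟩ := hc.exists_loop_state_next_ne hα hcyc
    (w := r ++ [b]) hq (by
      intro a ha
      rcases List.mem_append.1 ha with ha | ha
      exacts [hr a ha, by rwa [List.mem_singleton.1 ha]])
    (by rw [run_append, hqp]; exact hpp') hp' (by simp) hbα
  have hyT := hc.total_diff_of_next hdΓ hα hdα hy' hyy'
  refine hasLoop_of_forall_mem (q := y) fun k => ?_
  have hk : ∀ a ∈ List.replicate k b, a ∈ Γ \ {α} := fun a ha => by
    rw [List.eq_of_mem_replicate ha]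
    exact ⟨hb, hbα⟩
  obtain ⟨z, hz⟩ := Option.ne_none_iff_exists'.1 (hyT _ hk)
  refine ⟨z, ?_, hz⟩
  by_contra hzC
  exact hc.false_of_cycle_of_total hα hy hn hycyc (fun a ha => (hk a ha).1) hz hzC
    (hyT.of_run hk hz)

theorem not_hasLoop [Finite Q] [Finite S] (hc : Core δ Γ C) {α : S} (hα : α ∈ Γ) :
    ¬ HasLoop δ C α := by
  intro hloop
  obtain ⟨x, hx, e, he, z, hzC, hz⟩ := hc.exists_exit_edge
  obtain ⟨a, ha, x', hx', hxx'⟩ := hc.exists_next_mem hx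
  -- A third letter `b` makes `x`, and hence `z`, total for `Γ \ {b}`. Without one, `Γ \ {a}`
  -- contains at most `e`, which can be repeated at `z`.
  by_cases hthree : ∃ b ∈ Γ, b ≠ a ∧ b ≠ e
  · obtain ⟨b, hb, hba, hbe⟩ := hthree
    refine hc.not_total_of_hasLoop hb (hc.hasLoop_of_hasLoop hα hb hloop) hx he hz hzC ?_
    exact (hc.total_diff_of_next ha hb hba.symm hx' hxx').of_run (w := [e])
      (by simpa using ⟨he, hbe.symm⟩) hz
  · push Not at hthree
    refine hc.not_total_of_hasLoop ha (hc.hasLoop_of_hasLoop hα ha hloop) hx he hz hzC ?_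
    refine ((hc.total_single he (by simp [hz])).of_run (w := [e]) (by simp) hz).mono ?_
    rintro b ⟨hb, hba⟩
    exact hthree b hb hba

protected theorem false [Finite Q] [Finite S] (hc : Core δ Γ C) : False := by
  obtain ⟨x, hx⟩ := hc.nonempty
  obtain ⟨a, ha, y, hy, hxy⟩ := hc.exists_next_mem hx
  obtain ⟨w, hw, hyx⟩ := hc.connected y hy x hx
  obtain ⟨V, hV⟩ := (Set.toFinite {V | IsCycleSet δ Γ C V}).exists_minimal
    ⟨{b | b ∈ a :: w}, x, hx, a :: w, by simp, by simpa using ⟨ha, hw⟩,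
      by rw [run_cons_some, hxy, hyx], fun _ => Iff.rfl⟩
  have hmin : ∀ V', IsCycleSet δ Γ C V' → V' ⊆ V → V ⊆ V' := fun V' hV' => hV.le_of_le hV'
  have hVset : IsCycleSet δ Γ C V := hV.prop
  obtain ⟨q, hq, v, hvne, hvΓ, hloop, hVv⟩ := id hVset
  obtain ⟨α, v', hv'⟩ := List.exists_cons_of_ne_nil hvne
  have hαV : α ∈ V := (hVv α).2 (by simp [hv'])
  by_cases hsingle : ∀ d ∈ V, α = d
  · refine hc.not_hasLoop (hvΓ α ((hVv α).1 hαV)) ⟨q, hq, v.length, ?_, ?_⟩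
    · exact List.length_pos_iff.2 hvne
    · rwa [← List.eq_replicate_of_mem fun b hb => (hsingle b ((hVv b).2 hb)).symm]
  · push Not at hsingle
    obtain ⟨d, hd, hαd⟩ := hsingle
    by_cases hproper : ∃ e ∈ Γ, e ∉ V
    · obtain ⟨e, he, heV⟩ := hproper
      exact hc.false_of_two_le hVset hmin hαV hd hαd he heV
    · push Not at hproper
      obtain rfl : V = Γ := Set.Subset.antisymm (fun b hb => hvΓ b ((hVv b).1 hb)) hproper
      exact hc.false_of_full_cycles hmin

end Core

/-! ### Back to the quasi-equation -/

theorem commutesOn_univ [Finite Q] [Finite S]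
    (hM : ¬ InherentlyNonDualizable (AutomaticAlgebra δ)) : CommutesOn δ Set.univ := by
  by_contra h
  obtain ⟨Γ, C, hc⟩ := exists_core hM h
  exact hc.false

theorem foldl_mul_zero (l : List (AutomaticAlgebra δ)) : l.foldl (· * ·) zero = zero := by
  induction l with
  | nil => rfl
  | cons a l ih => rw [List.foldl_cons, zero_mul', ih]

theorem eq_state_and_eq_letter_of_mul_ne {x a : AutomaticAlgebra δ} (h : x * a ≠ zero) :
    (∃ q, x = state q) ∧ ∃ s, a = letter s := by
  cases x with
  | zero => exact absurd (zero_mul' δ a) h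
  | letter s => exact absurd (ofLetter_mul δ (some s) a) h
  | state q =>
    refine ⟨⟨q, rfl⟩, ?_⟩
    cases a with
    | zero => exact absurd rfl h
    | state r => exact absurd rfl h
    | letter s => exact ⟨s, rfl⟩

theorem forall_mem_eq_letter_of_foldl_ne {x : AutomaticAlgebra δ} {l : List (AutomaticAlgebra δ)}
    (h : l.foldl (· * ·) x ≠ zero) : ∀ a ∈ l, ∃ s, a = letter s := by
  induction l generalizing x with
  | nil => simp
  | cons b l ih =>
    rw [List.foldl_cons] at h
    intro a ha
    rcases List.mem_cons.1 ha with rfl | ha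
    · refine (eq_state_and_eq_letter_of_mul_ne (x := x) fun h0 => h ?_).2
      rw [h0, foldl_mul_zero]
    · exact ih h a ha

theorem exists_eq_state_of_foldl_ne {x : AutomaticAlgebra δ} {l : List (AutomaticAlgebra δ)}
    (hl : l ≠ []) (h : l.foldl (· * ·) x ≠ zero) : ∃ q, x = state q := by
  obtain ⟨a, l, rfl⟩ := List.exists_cons_of_ne_nil hl
  rw [List.foldl_cons] at h
  refine (eq_state_and_eq_letter_of_mul_ne (a := a) fun h0 => h ?_).1
  rw [h0, foldl_mul_zero]

theorem foldl_mul_letter (o : Option Q) (w : List S) :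
    (w.map letter).foldl (· * ·) (ofState δ o) = ofState δ (run δ o w) := by
  induction w generalizing o with
  | nil => rfl
  | cons a w ih =>
    rw [List.map_cons, List.foldl_cons, show (letter a : AutomaticAlgebra δ) = ofLetter δ (some a)
      from rfl, ofState_mul_ofLetter, ih]
    rfl

/-- A non-zero product with at least one factor `yᵢ` forces `x` to be a state and all `yᵢ` to be
letters, so the quasi-equation reduces to readability of permuted words. -/
theorem satisfiesPermQuasiEquation [Finite Q] [Finite S]
    (hM : ¬ InherentlyNonDualizable (AutomaticAlgebra δ)) (m : ℕ) (φ : Equiv.Perm (Fin m)) :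
    SatisfiesPermQuasiEquation (AutomaticAlgebra δ) m φ := by
  intro x y hxy
  by_contra hne
  have hm : List.ofFn (fun i => y (φ i)) ≠ [] := by
    intro h
    have h0 : m = 0 := by simpa using congrArg List.length h
    subst h0
    exact hne (by simpa [leftProd] using hxy)
  obtain ⟨q, rfl⟩ := exists_eq_state_of_foldl_ne hm hne
  have hlet : ∀ i, ∃ s, y i = letter s := by
    intro i
    refine forall_mem_eq_letter_of_foldl_ne hne (y i) ?_
    rw [List.mem_ofFn]
    exact ⟨φ.symm i, by simp⟩
  choose f hf using hlet
  have hrun : ∀ g : Fin m → S, leftProd (state q : AutomaticAlgebra δ) (fun i => letter (g i)) =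
      ofState δ (run δ (some q) (List.ofFn g)) := by
    intro g
    rw [← foldl_mul_letter, List.map_ofFn]
    rfl
  obtain rfl : y = fun i => letter (f i) := funext hf
  rw [hrun] at hxy
  rw [hrun fun i => f (φ i)] at hne
  refine commutesOn_univ hM q _ _ (Equiv.Perm.ofFn_comp_perm φ f) (by simp) ?_
    (ofState_injective δ hxy)
  intro h
  exact hne (congrArg (ofState δ) h)

end AutomaticAlgebra

theorem theorem2p6 {Q : Type u} {S : Type v} [Finite Q] [Finite S] (δ : Q → S → Option Q)
    (m : ℕ) (φ : Equiv.Perm (Fin m))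
    (hfail : ¬ SatisfiesPermQuasiEquation (AutomaticAlgebra δ) m φ) :
    InherentlyNonDualizable (AutomaticAlgebra δ) := by
  by_contra hM
  exact hfail (AutomaticAlgebra.satisfiesPermQuasiEquation hM m φ)
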